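/- \textbf{Setting.} Let $\mathcal A$ be a set of atoms. Literals are atoms $a$ and negated atoms $\bar a$, with $\bar{\bar a}=a$. Formulas of $\mathsf{BV}$ are generated by the unit $\mathbb I$, literals, and the connectives $⅋$ (par), $\lhd$ (seq), $\otimes$ (tensor). Rule instances of $\mathsf{BV}$ (premise $\to$ conclusion) are: \begin{itemize} \item $\equiv$: an equation, in either direction, among associativity of $⅋,\lhd,\otimes$; commutativity of $⅋,\otimes$; $A⅋\mathbb I\equiv A$, $A\otimes\mathbb I\equiv A$, $A\lhd\mathbb I\equiv A\equiv\mathbb I\lhd A$; \item $\mathsf{ai}{\downarrow}$: $\mathbb I\to a⅋\bar a$ for a literal $a$; \item $\mathsf s$: $A\otimes(B⅋C)\to(A\otimes B)⅋C$; \item $\mathsf q{\downarrow}$: $(A⅋B)\lhd(C⅋D)\to(A\lhd C)⅋(B\lhd D)$. \end{itemize} Derivations (open deduction) are generated from formulas (with premise and conclusion that formula) by combining two derivations with $⅋$, $\lhd$ or $\otimes$, and by composing vertically a derivation with conclusion $X$, a rule instance $X\to Y$ and a derivation with premise $Y$. A \emph{proof} of $A$ is a derivation $\mathbb I\to A$.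 An \emph{atomic flow} $p\to q$ between strings of literals is a two-dimensional diagram built by vertical and horizontal composition from the empty flow, wires $a\to a$, crossings $ab\to ba$, caps $\varepsilon\to a\bar a$ and cups $a\bar a\to\varepsilon$ ($a,b$ literals). Diagrams are taken modulo associativity and unit laws of both compositions, the interchange law, and the following equations: a crossing is inverse to the reversed crossing; Yang--Baxter; a cap on $\bar a,a$ followed by a crossing is the cap on $a,\bar a$, and dually for cups; a wire may be slid across a cap or a cup. The string of a formula lists its literal occurrences from left to right. The atomic flow $\mathsf{AF}(\Phi)$ of a derivation $\Phi\colon A\to B$ goes from the string of $A$ to the string of $B$: a formula gives identity wires, connectives give horizontal composition, vertical composition gives vertical composition. On rules, $\mathsf{ai}{\downarrow}$ gives a cap, $\mathsf s$ and the associativity and unit equations give identities, commutativity gives the crossing of the two subformulas, and $\mathsf q{\downarrow}$ gives the crossing of $B$ and $C$ between the identities on $A$ and $D$. \textbf{Lemma (Splitting, improved formulation).} Let $A$, $B$, $K$ be formulas and let $a$ be a literal. \begin{enumerate} \item For every proof $\Phi$ of $(A\otimes B)⅋K$ in $\mathsf{BV}$ there are formulas $K_A,K_B$, a derivation $\Phi_K\colon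 K_A⅋K_B\to K$ and proofs $\Phi_A$ of $A⅋K_A$ and $\Phi_B$ of $B⅋K_B$ in $\mathsf{BV}$ such that the proof $$\mathbb I\equiv\mathbb I\otimes\mathbb I\xrightarrow{\Phi_A\otimes\Phi_B}(A⅋K_A)\otimes(B⅋K_B)\xrightarrow{\mathsf s,\equiv}(A\otimes B)⅋(K_A⅋K_B)\xrightarrow{(A\otimes B)⅋\Phi_K}(A\otimes B)⅋K$$ has the same atomic flow as $\Phi$. Here the step labelled $\mathsf s,\equiv$ is the derivation made of a switch to $((A⅋K_A)\otimes B)⅋K_B$; then, inside, commutativity, a switch and commutativity, giving $((A\otimes B)⅋K_A)⅋K_B$; then associativity. \item For every proof $\Phi$ of $(A\lhd B)⅋K$ in $\mathsf{BV}$ there are formulas $K_A,K_B$, a derivation $\Phi_K\colon K_A\lhd K_B\to K$ and proofs $\Phi_A$ of $A⅋K_A$ and $\Phi_B$ of $B⅋K_B$ in $\mathsf{BV}$ such that the proof $$\mathbb I\equiv\mathbb I\lhd\mathbb I\xrightarrow{\Phi_A\lhd\Phi_B}(A⅋K_A)\lhd(B⅋K_B)\xrightarrow{\mathsf q{\downarrow}}(A\lhd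 B)⅋(K_A\lhd K_B)\xrightarrow{(A\lhd B)⅋\Phi_K}(A\lhd B)⅋K$$ has the same atomic flow as $\Phi$. \item For every proof $\Phi$ of $a⅋K$ in $\mathsf{BV}$ there is a derivation $\Phi_a\colon\bar a\to K$ in $\mathsf{BV}$ such that the proof $$\mathbb I\xrightarrow{\mathsf{ai}{\downarrow}}a⅋\bar a\xrightarrow{a⅋\Phi_a}a⅋K$$ has the same atomic flow as $\Phi$. \end{enumerate} -/

import Mathlib

namespace BV

universe u

/-- Literals over a set of atoms: an atom or a negated atom. -/
inductive Literal (𝒜 : Type u) : Type u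
  | pos (a : 𝒜) : Literal 𝒜
  | neg (a : 𝒜) : Literal 𝒜

/-- The dual literal; it is an involution by definition. -/
def Literal.dual {𝒜 : Type u} : Literal 𝒜 → Literal 𝒜
  | .pos a => .neg a
  | .neg a => .pos a

/-- Formulas of `BV`: unit, literals (atoms and negated atoms), par, seq and tensor. -/
inductive Formula (𝒜 : Type u) : Type u
  | unit : Formula 𝒜
  | lit (a : Literal 𝒜) : Formula 𝒜
  | par (A B : Formula 𝒜) : Formula 𝒜
  | seq (A B : Formula 𝒜) : Formula 𝒜
  | tens (A B : Formula 𝒜) : Formula 𝒜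

/-- The string of literal occurrences of a formula, from left to right. -/
def Formula.str {𝒜 : Type u} : Formula 𝒜 → List (Literal 𝒜)
  | .unit => []
  | .lit a => [a]
  | .par A B => A.str ++ B.str
  | .seq A B => A.str ++ B.str
  | .tens A B => A.str ++ B.str

/-! ### Derivations in open deduction -/

/-- The defining equations of the formula equivalence, read from left to right. They are data:
the atomic flow of an instance depends on the equation that is used. -/
inductive EqAx {𝒜 : Type u} : Formula 𝒜 → Formula 𝒜 → Type u
  | tensAssoc (A B C : Formula 𝒜) : EqAx (.tens (.tens A B) C) (.tens A (.tens B C))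
  | tensComm (A B : Formula 𝒜) : EqAx (.tens A B) (.tens B A)
  | tensUnit (A : Formula 𝒜) : EqAx (.tens A .unit) A
  | parAssoc (A B C : Formula 𝒜) : EqAx (.par (.par A B) C) (.par A (.par B C))
  | parComm (A B : Formula 𝒜) : EqAx (.par A B) (.par B A)
  | parUnit (A : Formula 𝒜) : EqAx (.par A .unit) A
  | seqAssoc (A B C : Formula 𝒜) : EqAx (.seq (.seq A B) C) (.seq A (.seq B C))
  | seqUnitRight (A : Formula 𝒜) : EqAx (.seq A .unit) A
  | seqUnitLeft (A : Formula 𝒜) : EqAx (.seq .unit A) A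

/-- `Rule A B` is the type of instances of inference rules of `BV` with premise `A` and
conclusion `B`: an equation applied in either direction, atomic interaction down, switch, and
sequentiality down. -/
inductive Rule {𝒜 : Type u} : Formula 𝒜 → Formula 𝒜 → Type u
  | equiv {A B : Formula 𝒜} (e : EqAx A B) : Rule A B
  | equivSymm {A B : Formula 𝒜} (e : EqAx A B) : Rule B A
  | aiDown (a : Literal 𝒜) : Rule .unit (.par (.lit a) (.lit a.dual))
  | switch (A B C : Formula 𝒜) : Rule (.tens A (.par B C)) (.par (.tens A B) C)
  | qDown (A B C D : Formula 𝒜) :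
      Rule (.seq (.par A B) (.par C D)) (.par (.seq A C) (.seq B D))

/-- `Deriv A B` is the type of derivations in `BV` with premise `A` and conclusion `B`. -/
inductive Deriv {𝒜 : Type u} : Formula 𝒜 → Formula 𝒜 → Type u
  | form (A : Formula 𝒜) : Deriv A A
  | par {A B C D : Formula 𝒜} (Φ : Deriv A B) (Ψ : Deriv C D) : Deriv (.par A C) (.par B D)
  | seq {A B C D : Formula 𝒜} (Φ : Deriv A B) (Ψ : Deriv C D) : Deriv (.seq A C) (.seq B D)
  | tens {A B C D : Formula 𝒜} (Φ : Deriv A B) (Ψ : Deriv C D) : Deriv (.tens A C) (.tens B D)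
  | step {A B C D : Formula 𝒜} (Φ : Deriv A B) (r : Rule B C) (Ψ : Deriv C D) : Deriv A D

/-- A proof of `A` is a derivation with premise the unit and conclusion `A`. -/
abbrev Proof {𝒜 : Type u} (A : Formula 𝒜) : Type u := Deriv .unit A

/-! ### Atomic flows -/

/-- Terms for atomic flows with given input and output strings: the empty flow, wires, simple
crossings, caps and cups, closed under vertical and horizontal composition. -/
inductive FlowTerm {𝒜 : Type u} : List (Literal 𝒜) → List (Literal 𝒜) → Type u
  | empty : FlowTerm [] []
  | wire (a : Literal 𝒜) : FlowTerm [a] [a]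
  | cross (a b : Literal 𝒜) : FlowTerm [a, b] [b, a]
  | cap (a : Literal 𝒜) : FlowTerm [] [a, a.dual]
  | cup (a : Literal 𝒜) : FlowTerm [a, a.dual] []
  | vcomp {p q s : List (Literal 𝒜)} (φ : FlowTerm p q) (ψ : FlowTerm q s) : FlowTerm p s
  | hcomp {p q s t : List (Literal 𝒜)} (φ : FlowTerm p q) (ψ : FlowTerm s t) :
      FlowTerm (p ++ s) (q ++ t)

/-- The identity flow on a string: parallel wires. -/
def FlowTerm.id {𝒜 : Type u} : (p : List (Literal 𝒜)) → FlowTerm p p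
  | [] => .empty
  | a :: p => .hcomp (.wire a) (FlowTerm.id p)

/-- The identity flow between two strings that are equal (such as `(p ++ q) ++ s` and
`p ++ (q ++ s)`). -/
def FlowTerm.idOf {𝒜 : Type u} {p q : List (Literal 𝒜)} (h : p = q) : FlowTerm p q :=
  h ▸ FlowTerm.id p

/-- One wire crossing all the wires of a string, from left to right. -/
def FlowTerm.crossOne {𝒜 : Type u} (a : Literal 𝒜) :
    (q : List (Literal 𝒜)) → FlowTerm (a :: q) (q ++ [a])
  | [] => .wire a
  | b :: q =>
      .vcomp (q := b :: a :: q) (.hcomp (.cross a b) (FlowTerm.id q))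
        (.hcomp (.wire b) (FlowTerm.crossOne a q))

/-- The crossing of two bundles of wires, made of simple crossings. -/
def FlowTerm.crossing {𝒜 : Type u} :
    (p q : List (Literal 𝒜)) → FlowTerm (p ++ q) (q ++ p)
  | [], q => FlowTerm.idOf (List.append_nil q).symm
  | a :: p, q =>
      .vcomp (q := a :: (q ++ p)) (.hcomp (.wire a) (FlowTerm.crossing p q))
        (.vcomp (.hcomp (FlowTerm.crossOne a q) (FlowTerm.id p))
          (FlowTerm.idOf (List.append_cons q a p).symm))

/-- Equality of terms as two-dimensional diagrams: the least congruence that contains the laws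
of diagram composition (associativity and units of both compositions, interchange) and the
equations of atomic flows for crossings, caps and cups. The two sides may have input and output
strings that are equal but written differently, such as `(p ++ q) ++ s` and `p ++ (q ++ s)`. -/
inductive FlowEq {𝒜 : Type u} : {p q p' q' : List (Literal 𝒜)} →
    FlowTerm p q → FlowTerm p' q' → Prop
  | refl {p q : List (Literal 𝒜)} (φ : FlowTerm p q) : FlowEq φ φ
  | symm {p q p' q' : List (Literal 𝒜)} {φ : FlowTerm p q} {φ' : FlowTerm p' q'} :
      FlowEq φ φ' → FlowEq φ' φ
  | trans {p q p' q' p'' q'' : List (Literal 𝒜)} {φ : FlowTerm p q} {φ' : FlowTerm p' q'}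
      {φ'' : FlowTerm p'' q''} : FlowEq φ φ' → FlowEq φ' φ'' → FlowEq φ φ''
  | vcongr {p q s p' q' s' : List (Literal 𝒜)} {φ : FlowTerm p q} {ψ : FlowTerm q s}
      {φ' : FlowTerm p' q'} {ψ' : FlowTerm q' s'} :
      FlowEq φ φ' → FlowEq ψ ψ' → FlowEq (.vcomp φ ψ) (.vcomp φ' ψ')
  | hcongr {p q s t p' q' s' t' : List (Literal 𝒜)} {φ : FlowTerm p q} {ψ : FlowTerm s t}
      {φ' : FlowTerm p' q'} {ψ' : FlowTerm s' t'} :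
      FlowEq φ φ' → FlowEq ψ ψ' → FlowEq (.hcomp φ ψ) (.hcomp φ' ψ')
  | vassoc {p q s t : List (Literal 𝒜)} (φ : FlowTerm p q) (ψ : FlowTerm q s)
      (θ : FlowTerm s t) : FlowEq (.vcomp (.vcomp φ ψ) θ) (.vcomp φ (.vcomp ψ θ))
  | id_vcomp {p q : List (Literal 𝒜)} (φ : FlowTerm p q) :
      FlowEq (.vcomp (FlowTerm.id p) φ) φ
  | vcomp_id {p q : List (Literal 𝒜)} (φ : FlowTerm p q) :
      FlowEq (.vcomp φ (FlowTerm.id q)) φ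
  | hassoc {p q s t v w : List (Literal 𝒜)} (φ : FlowTerm p q) (ψ : FlowTerm s t)
      (θ : FlowTerm v w) : FlowEq (.hcomp (.hcomp φ ψ) θ) (.hcomp φ (.hcomp ψ θ))
  | empty_hcomp {p q : List (Literal 𝒜)} (φ : FlowTerm p q) : FlowEq (.hcomp .empty φ) φ
  | hcomp_empty {p q : List (Literal 𝒜)} (φ : FlowTerm p q) : FlowEq (.hcomp φ .empty) φ
  | interchange {p q s p' q' s' : List (Literal 𝒜)} (φ : FlowTerm p q) (φ' : FlowTerm q s)
      (ψ : FlowTerm p' q') (ψ' : FlowTerm q' s') :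
      FlowEq (.hcomp (.vcomp φ φ') (.vcomp ψ ψ')) (.vcomp (.hcomp φ ψ) (.hcomp φ' ψ'))
  | cross_cross (a b : Literal 𝒜) :
      FlowEq (.vcomp (.cross a b) (.cross b a)) (FlowTerm.id [a, b])
  | yangBaxter (a b c : Literal 𝒜) :
      FlowEq
        (.vcomp (q := [b, a, c]) (.hcomp (.cross a b) (.wire c))
          (.vcomp (q := [b, c, a]) (.hcomp (.wire b) (.cross a c)) (.hcomp (.cross b c) (.wire a))))
        (.vcomp (q := [a, c, b]) (.hcomp (.wire a) (.cross b c))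
          (.vcomp (q := [c, a, b]) (.hcomp (.cross a c) (.wire b)) (.hcomp (.wire c) (.cross a b))))
  | cap_cross_pos (a : 𝒜) :
      FlowEq (.vcomp (.cap (.neg a)) (.cross (.neg a) (.pos a))) (.cap (.pos a))
  | cap_cross_neg (a : 𝒜) :
      FlowEq (.vcomp (.cap (.pos a)) (.cross (.pos a) (.neg a))) (.cap (.neg a))
  | cross_cup_pos (a : 𝒜) :
      FlowEq (.vcomp (.cross (.pos a) (.neg a)) (.cup (.neg a))) (.cup (.pos a))
  | cross_cup_neg (a : 𝒜) :
      FlowEq (.vcomp (.cross (.neg a) (.pos a)) (.cup (.pos a))) (.cup (.neg a))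
  | cap_slide (a b : Literal 𝒜) :
      FlowEq (.vcomp (q := [a, a.dual, b]) (.hcomp (.cap a) (.wire b)) (.hcomp (.wire a) (.cross a.dual b)))
        (.vcomp (q := [b, a, a.dual]) (.hcomp (.wire b) (.cap a)) (.hcomp (.cross b a) (.wire a.dual)))
  | cup_slide (a b : Literal 𝒜) :
      FlowEq (.vcomp (q := [a, a.dual, b]) (.hcomp (.wire a) (.cross b a.dual)) (.hcomp (.cup a) (.wire b)))
        (.vcomp (q := [b, a, a.dual]) (.hcomp (.cross a b) (.wire a.dual)) (.hcomp (.wire b) (.cup a)))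

/-- Equality of diagrams with fixed input and output as a setoid. -/
def flowSetoid {𝒜 : Type u} (p q : List (Literal 𝒜)) : Setoid (FlowTerm p q) where
  r φ ψ := FlowEq φ ψ
  iseqv := ⟨FlowEq.refl, FlowEq.symm, FlowEq.trans⟩

/-- Atomic flows with input `p` and output `q`. -/
def AtomicFlow {𝒜 : Type u} (p q : List (Literal 𝒜)) : Type u := Quotient (flowSetoid p q)

/-! ### The atomic flow of a derivation -/

/-- The atomic flow of an equation: a crossing for commutativity, an identity otherwise. -/
def EqAx.flowTerm {𝒜 : Type u} : {A B : Formula 𝒜} → EqAx A B → FlowTerm A.str B.str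
  | _, _, .tensAssoc A B C => FlowTerm.idOf (List.append_assoc A.str B.str C.str)
  | _, _, .tensComm A B => FlowTerm.crossing A.str B.str
  | _, _, .tensUnit A => FlowTerm.idOf (List.append_nil A.str)
  | _, _, .parAssoc A B C => FlowTerm.idOf (List.append_assoc A.str B.str C.str)
  | _, _, .parComm A B => FlowTerm.crossing A.str B.str
  | _, _, .parUnit A => FlowTerm.idOf (List.append_nil A.str)
  | _, _, .seqAssoc A B C => FlowTerm.idOf (List.append_assoc A.str B.str C.str)
  | _, _, .seqUnitRight A => FlowTerm.idOf (List.append_nil A.str)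
  | _, _, .seqUnitLeft A => FlowTerm.id A.str

/-- The atomic flow of an equation that is read from right to left. -/
def EqAx.flowTermSymm {𝒜 : Type u} : {A B : Formula 𝒜} → EqAx A B → FlowTerm B.str A.str
  | _, _, .tensAssoc A B C => FlowTerm.idOf (List.append_assoc A.str B.str C.str).symm
  | _, _, .tensComm A B => FlowTerm.crossing B.str A.str
  | _, _, .tensUnit A => FlowTerm.idOf (List.append_nil A.str).symm
  | _, _, .parAssoc A B C => FlowTerm.idOf (List.append_assoc A.str B.str C.str).symm
  | _, _, .parComm A B => FlowTerm.crossing B.str A.str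
  | _, _, .parUnit A => FlowTerm.idOf (List.append_nil A.str).symm
  | _, _, .seqAssoc A B C => FlowTerm.idOf (List.append_assoc A.str B.str C.str).symm
  | _, _, .seqUnitRight A => FlowTerm.idOf (List.append_nil A.str).symm
  | _, _, .seqUnitLeft A => FlowTerm.id A.str

/-- The atomic flow of a rule instance: a cap for atomic interaction, an identity for switch, and
a crossing of the two middle formulas for sequentiality. -/
def Rule.flowTerm {𝒜 : Type u} : {A B : Formula 𝒜} → Rule A B → FlowTerm A.str B.str
  | _, _, .equiv e => e.flowTerm
  | _, _, .equivSymm e => e.flowTermSymm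
  | _, _, .aiDown a => .cap a
  | _, _, .switch A B C => FlowTerm.idOf (List.append_assoc A.str B.str C.str).symm
  | _, _, .qDown A B C D =>
      .vcomp
        (FlowTerm.idOf (show (A.str ++ B.str) ++ (C.str ++ D.str)
            = A.str ++ ((B.str ++ C.str) ++ D.str) by simp only [List.append_assoc]))
        (.vcomp
          (.hcomp (FlowTerm.id A.str)
            (.hcomp (FlowTerm.crossing B.str C.str) (FlowTerm.id D.str)))
          (FlowTerm.idOf (show A.str ++ ((C.str ++ B.str) ++ D.str)
            = (A.str ++ C.str) ++ (B.str ++ D.str) by simp only [List.append_assoc])))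

/-- The term for the atomic flow of a derivation. -/
def Deriv.flowTerm {𝒜 : Type u} : {A B : Formula 𝒜} → Deriv A B → FlowTerm A.str B.str
  | _, _, .form A => FlowTerm.id A.str
  | _, _, .par Φ Ψ => .hcomp Φ.flowTerm Ψ.flowTerm
  | _, _, .seq Φ Ψ => .hcomp Φ.flowTerm Ψ.flowTerm
  | _, _, .tens Φ Ψ => .hcomp Φ.flowTerm Ψ.flowTerm
  | _, _, .step Φ r Ψ => .vcomp Φ.flowTerm (.vcomp r.flowTerm Ψ.flowTerm)

/-- The atomic flow of a derivation. -/
def Deriv.flow {𝒜 : Type u} {A B : Formula 𝒜} (Φ : Deriv A B) : AtomicFlow A.str B.str :=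
  Quotient.mk (flowSetoid A.str B.str) Φ.flowTerm

/-! ### The recombined derivations -/

/-- From proofs of `A ⅋ K₁` and `B ⅋ K₂` and a derivation from `K₁ ⅋ K₂` to `K`, the proof
`𝕀 ≡ 𝕀 ⊗ 𝕀 → (A ⅋ K₁) ⊗ (B ⅋ K₂) → (A ⊗ B) ⅋ (K₁ ⅋ K₂) → (A ⊗ B) ⅋ K`. The middle part is
switch (which yields `((A ⅋ K₁) ⊗ B) ⅋ K₂`), then commutativity, switch and commutativity inside
(which yield `((A ⊗ B) ⅋ K₁) ⅋ K₂`), then associativity. -/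
def recombineTens {𝒜 : Type u} {A B K₁ K₂ K : Formula 𝒜} (ΦA : Proof (.par A K₁))
    (ΦB : Proof (.par B K₂)) (ΦK : Deriv (.par K₁ K₂) K) : Proof (.par (.tens A B) K) :=
  .step (.form .unit) (.equivSymm (.tensUnit .unit))
    (.step (.tens ΦA ΦB) (.switch (.par A K₁) B K₂)
      (.step
        (.par
          (.step (.form _) (.equiv (.tensComm (.par A K₁) B))
            (.step (.form _) (.switch B A K₁)
              (.par (.step (.form _) (.equiv (.tensComm B A)) (.form _)) (.form K₁))))
          (.form K₂))
        (.equiv (.parAssoc (.tens A B) K₁ K₂))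
        (.par (.form (.tens A B)) ΦK)))

/-- From proofs of `A ⅋ K₁` and `B ⅋ K₂` and a derivation from `K₁ ◁ K₂` to `K`, the proof
`𝕀 ≡ 𝕀 ◁ 𝕀 → (A ⅋ K₁) ◁ (B ⅋ K₂) → (A ◁ B) ⅋ (K₁ ◁ K₂) → (A ◁ B) ⅋ K`, where the middle
part is one instance of sequentiality. -/
def recombineSeq {𝒜 : Type u} {A B K₁ K₂ K : Formula 𝒜} (ΦA : Proof (.par A K₁))
    (ΦB : Proof (.par B K₂)) (ΦK : Deriv (.seq K₁ K₂) K) : Proof (.par (.seq A B) K) :=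
  .step (.form .unit) (.equivSymm (.seqUnitRight .unit))
    (.step (.seq ΦA ΦB) (.qDown A K₁ B K₂) (.par (.form (.seq A B)) ΦK))

/-- From a derivation from the dual of `a` to `K`, the proof `𝕀 → a ⅋ ā → a ⅋ K`. -/
def recombineLit {𝒜 : Type u} {a : Literal 𝒜} {K : Formula 𝒜}
    (Φa : Deriv (.lit a.dual) K) : Proof (.par (.lit a) K) :=
  .step (.form .unit) (.aiDown a) (.par (.form (.lit a)) Φa)

end BV

-- The flow is first ignored, splitting is proved for mere derivability, and the flow is recovered
-- because proofs whose literals are all distinct leave no choice for it.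
--
-- Splitting for derivability is semantic. Sets of formulas closed under derivability carry two
-- products, `parSet` and `seqSet`, with the provable formulas as common unit, and `q↓` is an
-- interchange law between them. A formula is interpreted in a Chu-like construction over these
-- sets: a pair `posDen`, `negDen` whose members have provable pars. Tensor and par are the Chu
-- tensor and its dual, and seq acts componentwise. Every rule is a morphism of pairs
-- (`Rule.den_subset`), and a formula always belongs to its own `negDen` (`mem_negDen_self`). Hence
-- a proof of `A ⅋ K` puts `K` into `A.posDen` (`Deriv.mem_posDen`). No closure operator is applied
-- to the positive part of a tensor, a seq or a literal, so this membership is literally the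
-- decomposition that splitting asks for.
--
-- For the flows: derivations of `BV` produce no cups. In a cup-free flow without inputs each output
-- wire is one end of a cap whose other end is also an output. If no literal occurs twice in the
-- output string, the string determines this matching, and the equations of flows reduce every such
-- flow to a normal form read off from the matching (`CupFree.flowEq_of_nodup`).
--
-- A given proof need not have distinct literals, but it is the image, under erasure of numbers, of
-- a proof in which each `ai↓` creates an atom with its own number (`Deriv.exists_lift_nodup`).
-- Splitting is applied to this lift. The recombined proof and the lift prove the same formula with
-- distinct literals, so they have equal flows, and erasing the numbers preserves this equality
-- (`FlowEq.map`).

namespace BV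

universe u

/-! ### Splitting for derivability -/

/-- Derivability in `BV`. -/
def Derives {𝒜 : Type u} (A B : Formula 𝒜) : Prop := Nonempty (Deriv A B)

namespace Derives

variable {𝒜 : Type u} {A B C D : Formula 𝒜}

theorem refl (A : Formula 𝒜) : Derives A A := ⟨.form A⟩

theorem rule (r : Rule A B) : Derives A B := ⟨.step (.form A) r (.form B)⟩

/-- Vertical composition requires a rule instance in the middle, so a unit is added and removed
again. -/
theorem trans : Derives A B → Derives B C → Derives A C := fun ⟨Φ⟩ ⟨Ψ⟩ =>
  ⟨.step Φ (.equivSymm (.parUnit B)) (.step (.form _) (.equiv (.parUnit B)) Ψ)⟩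

theorem par : Derives A B → Derives C D → Derives (.par A C) (.par B D) :=
  fun ⟨Φ⟩ ⟨Ψ⟩ => ⟨.par Φ Ψ⟩

theorem seq : Derives A B → Derives C D → Derives (.seq A C) (.seq B D) :=
  fun ⟨Φ⟩ ⟨Ψ⟩ => ⟨.seq Φ Ψ⟩

theorem tens : Derives A B → Derives C D → Derives (.tens A C) (.tens B D) :=
  fun ⟨Φ⟩ ⟨Ψ⟩ => ⟨.tens Φ Ψ⟩

theorem parComm (A B : Formula 𝒜) : Derives (.par A B) (.par B A) :=
  rule (.equiv (.parComm A B))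

theorem parAssoc (A B C : Formula 𝒜) : Derives (.par (.par A B) C) (.par A (.par B C)) :=
  rule (.equiv (.parAssoc A B C))

theorem parAssocSymm (A B C : Formula 𝒜) : Derives (.par A (.par B C)) (.par (.par A B) C) :=
  rule (.equivSymm (.parAssoc A B C))

theorem parUnit (A : Formula 𝒜) : Derives (.par A .unit) A := rule (.equiv (.parUnit A))

theorem parUnitSymm (A : Formula 𝒜) : Derives A (.par A .unit) := rule (.equivSymm (.parUnit A))

theorem unitPar (A : Formula 𝒜) : Derives (.par .unit A) A := (parComm _ _).trans (parUnit A)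

theorem unitParSymm (A : Formula 𝒜) : Derives A (.par .unit A) :=
  (parUnitSymm A).trans (parComm _ _)

/-- A provable formula may be moved inside a tensor with a par of its context. -/
theorem of_proof_par {X : Formula 𝒜} (h : Derives .unit (.par X A)) :
    Derives B (.par (.tens X B) A) :=
  (rule (.equivSymm (.tensUnit B))).trans <| ((refl B).tens h).trans <|
    (rule (.switch B X A)).trans ((rule (.equiv (.tensComm B X))).par (refl A))

end Derives

-- Interpretation of formulas by orthogonal pairs of sets

variable {𝒜 : Type u}

/-- Sets of formulas closed under derivability. -/
def IsUp (X : Set (Formula 𝒜)) : Prop := ∀ ⦃K L⦄, K ∈ X → Derives K L → L ∈ X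

/-- Formulas derivable from a par of members of two sets. -/
def parSet (X Y : Set (Formula 𝒜)) : Set (Formula 𝒜) :=
  {K | ∃ x ∈ X, ∃ y ∈ Y, Derives (.par x y) K}

/-- Formulas derivable from a seq of members of two sets. -/
def seqSet (X Y : Set (Formula 𝒜)) : Set (Formula 𝒜) :=
  {K | ∃ x ∈ X, ∃ y ∈ Y, Derives (.seq x y) K}

/-- The two-sided residual of `parSet`, for Chu pairs `(X, X')` and `(Y, Y')`. -/
def resSet (X X' Y Y' : Set (Formula 𝒜)) : Set (Formula 𝒜) :=
  {K | (∀ x ∈ X, Formula.par K x ∈ Y') ∧ ∀ y ∈ Y, Formula.par K y ∈ X'}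

mutual
/-- Positive part of the denotation of a formula, to be thought of as a set of contexts in which
the formula is provable. -/
def Formula.posDen : Formula 𝒜 → Set (Formula 𝒜)
  | .unit => {K | Derives .unit K}
  | .lit a => {K | Derives (.lit a.dual) K}
  | .par A B => resSet A.negDen A.posDen B.negDen B.posDen
  | .seq A B => seqSet A.posDen B.posDen
  | .tens A B => parSet A.posDen B.posDen

/-- Negative part of the denotation of a formula. -/
def Formula.negDen : Formula 𝒜 → Set (Formula 𝒜)
  | .unit => {K | Derives .unit K}
  | .lit a => {K | Derives (.lit a) K}
  | .par A B => parSet A.negDen B.negDen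
  | .seq A B => seqSet A.negDen B.negDen
  | .tens A B => resSet A.posDen A.negDen B.posDen B.negDen
end

theorem isUp_parSet (X Y : Set (Formula 𝒜)) : IsUp (parSet X Y) :=
  fun _ _ ⟨x, hx, y, hy, h⟩ h' => ⟨x, hx, y, hy, h.trans h'⟩

theorem isUp_seqSet (X Y : Set (Formula 𝒜)) : IsUp (seqSet X Y) :=
  fun _ _ ⟨x, hx, y, hy, h⟩ h' => ⟨x, hx, y, hy, h.trans h'⟩

theorem isUp_resSet {X X' Y Y' : Set (Formula 𝒜)} (hX : IsUp X') (hY : IsUp Y') :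
    IsUp (resSet X X' Y Y') :=
  fun _ _ h h' => ⟨fun x hx => hY (h.1 x hx) (h'.par (.refl x)),
    fun y hy => hX (h.2 y hy) (h'.par (.refl y))⟩

theorem isUp_den (A : Formula 𝒜) : IsUp A.posDen ∧ IsUp A.negDen := by
  induction A with
  | unit => exact ⟨fun _ _ h h' => Derives.trans h h', fun _ _ h h' => Derives.trans h h'⟩
  | lit a => exact ⟨fun _ _ h h' => Derives.trans h h', fun _ _ h h' => Derives.trans h h'⟩
  | par A B hA hB => exact ⟨isUp_resSet hA.1 hB.1, isUp_parSet _ _⟩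
  | seq A B hA hB => exact ⟨isUp_seqSet _ _, isUp_seqSet _ _⟩
  | tens A B hA hB => exact ⟨isUp_parSet _ _, isUp_resSet hA.2 hB.2⟩

/-- The parts of a Chu pair are orthogonal. -/
theorem derives_par_of_mem_den (A : Formula 𝒜) :
    ∀ x ∈ A.posDen, ∀ y ∈ A.negDen, Derives .unit (.par x y) := by
  induction A with
  | unit => exact fun x hx y hy => (Derives.unitParSymm .unit).trans (Derives.par hx hy)
  | lit a =>
    refine fun x hx y hy => Derives.trans (Derives.trans (.rule (.aiDown a)) (.parComm _ _))
      (Derives.par hx hy)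
  | par A B hA hB =>
    rintro x hx y ⟨u, hu, v, hv, h⟩
    exact (hB _ (hx.1 u hu) v hv).trans ((Derives.parAssoc _ _ _).trans (.par (.refl x) h))
  | seq A B hA hB =>
    rintro x ⟨u, hu, v, hv, h⟩ y ⟨u', hu', v', hv', h'⟩
    exact (Derives.rule (.equivSymm (.seqUnitRight .unit))).trans <|
      ((hA u hu u' hu').seq (hB v hv v' hv')).trans <|
        (Derives.rule (.qDown u u' v v')).trans (h.par h')
  | tens A B hA hB =>
    rintro x ⟨u, hu, v, hv, h⟩ y hy
    exact ((hB v hv _ (hy.1 u hu)).trans (.parComm _ _)).trans <|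
      (Derives.parAssoc _ _ _).trans <|
        ((Derives.refl y).par h).trans (.parComm _ _)

/-- The tensor case is the only one with content. For `x` in `A.posDen`, orthogonality with `A ∈
A.negDen` makes `A ⅋ x` provable, and a switch then derives `(A ⊗ B) ⅋ x` from `B`, which lies in
`B.negDen`. -/
theorem mem_negDen_self (A : Formula 𝒜) : A ∈ A.negDen := by
  induction A with
  | unit => exact .refl _
  | lit a => exact .refl _
  | par A B hA hB => exact ⟨A, hA, B, hB, .refl _⟩
  | seq A B hA hB => exact ⟨A, hA, B, hB, .refl _⟩
  | tens A B hA hB =>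
    refine ⟨fun x hx => (isUp_den B).2 hB (.of_proof_par ?_), fun y hy =>
      (isUp_den A).2 hA ((Derives.of_proof_par ?_).trans
        (.par (.rule (.equiv (.tensComm B A))) (.refl y)))⟩
    · exact (derives_par_of_mem_den A x hx A hA).trans (.parComm _ _)
    · exact (derives_par_of_mem_den B y hy B hB).trans (.parComm _ _)

theorem derives_par_of_mem_posDen {A K : Formula 𝒜} (h : K ∈ A.posDen) :
    Derives .unit (.par A K) :=
  (derives_par_of_mem_den A K h A (mem_negDen_self A)).trans (.parComm _ _)

-- Algebra of the products and the residual

theorem parSet_mono {X X' Y Y' : Set (Formula 𝒜)} (h : X ⊆ X') (h' : Y ⊆ Y') :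
    parSet X Y ⊆ parSet X' Y' :=
  fun _ ⟨x, hx, y, hy, k⟩ => ⟨x, h hx, y, h' hy, k⟩

theorem seqSet_mono {X X' Y Y' : Set (Formula 𝒜)} (h : X ⊆ X') (h' : Y ⊆ Y') :
    seqSet X Y ⊆ seqSet X' Y' :=
  fun _ ⟨x, hx, y, hy, k⟩ => ⟨x, h hx, y, h' hy, k⟩

theorem resSet_mono {X X' Y Y' Z Z' W W' : Set (Formula 𝒜)} (hX : Z ⊆ X) (hX' : X' ⊆ Z')
    (hY : W ⊆ Y) (hY' : Y' ⊆ W') : resSet X X' Y Y' ⊆ resSet Z Z' W W' :=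
  fun _ h => ⟨fun x hx => hY' (h.1 x (hX hx)), fun y hy => hX' (h.2 y (hY hy))⟩

theorem parSet_comm (X Y : Set (Formula 𝒜)) : parSet X Y ⊆ parSet Y X :=
  fun _ ⟨x, hx, y, hy, h⟩ => ⟨y, hy, x, hx, (Derives.parComm y x).trans h⟩

theorem resSet_comm (X X' Y Y' : Set (Formula 𝒜)) : resSet X X' Y Y' ⊆ resSet Y Y' X X' :=
  fun _ h => ⟨h.2, h.1⟩

theorem parSet_assoc (X Y Z : Set (Formula 𝒜)) :
    parSet (parSet X Y) Z = parSet X (parSet Y Z) := by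
  ext K
  constructor
  · rintro ⟨w, ⟨x, hx, y, hy, h⟩, z, hz, h'⟩
    exact ⟨x, hx, _, ⟨y, hy, z, hz, .refl _⟩,
      (Derives.parAssocSymm _ _ _).trans ((h.par (.refl z)).trans h')⟩
  · rintro ⟨x, hx, w, ⟨y, hy, z, hz, h⟩, h'⟩
    exact ⟨_, ⟨x, hx, y, hy, .refl _⟩, z, hz,
      (Derives.parAssoc _ _ _).trans (((Derives.refl x).par h).trans h')⟩

theorem seqSet_assoc (X Y Z : Set (Formula 𝒜)) :
    seqSet (seqSet X Y) Z = seqSet X (seqSet Y Z) := by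
  ext K
  constructor
  · rintro ⟨w, ⟨x, hx, y, hy, h⟩, z, hz, h'⟩
    exact ⟨x, hx, _, ⟨y, hy, z, hz, .refl _⟩,
      (Derives.rule (.equivSymm (.seqAssoc x y z))).trans ((h.seq (.refl z)).trans h')⟩
  · rintro ⟨x, hx, w, ⟨y, hy, z, hz, h⟩, h'⟩
    exact ⟨_, ⟨x, hx, y, hy, .refl _⟩, z, hz,
      (Derives.rule (.equiv (.seqAssoc x y z))).trans (((Derives.refl x).seq h).trans h')⟩

/-- The formulas provable in `BV`. -/
abbrev provable : Set (Formula 𝒜) := {K | Derives .unit K}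

theorem parSet_provable {X : Set (Formula 𝒜)} (hX : IsUp X) : parSet X provable = X := by
  ext K
  constructor
  · rintro ⟨x, hx, y, hy, h⟩
    exact hX hx ((Derives.parUnitSymm x).trans (((Derives.refl x).par hy).trans h))
  · exact fun h => ⟨K, h, .unit, .refl _, .parUnit K⟩

theorem seqSet_provable {X : Set (Formula 𝒜)} (hX : IsUp X) : seqSet X provable = X := by
  ext K
  constructor
  · rintro ⟨x, hx, y, hy, h⟩
    exact hX hx ((Derives.rule (.equivSymm (.seqUnitRight x))).trans
      (((Derives.refl x).seq hy).trans h))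
  · exact fun h => ⟨K, h, .unit, .refl _, .rule (.equiv (.seqUnitRight K))⟩

theorem provable_seqSet {X : Set (Formula 𝒜)} (hX : IsUp X) : seqSet provable X = X := by
  ext K
  constructor
  · rintro ⟨y, hy, x, hx, h⟩
    exact hX hx ((Derives.rule (.equivSymm (.seqUnitLeft x))).trans
      ((Derives.seq hy (Derives.refl x)).trans h))
  · exact fun h => ⟨.unit, .refl _, K, h, .rule (.equiv (.seqUnitLeft K))⟩

/-- The pair `(X, X')` is orthogonal. -/
def IsOrth (X X' : Set (Formula 𝒜)) : Prop := ∀ x ∈ X, ∀ y ∈ X', Derives .unit (.par x y)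

/-- One inclusion tests the residual at the unit formula. In the other, orthogonality supplies the
condition on the members of `X`. -/
theorem resSet_provable {X X' : Set (Formula 𝒜)} (hX' : IsUp X') (h : IsOrth X X') :
    resSet X X' provable provable = X' := by
  ext K
  constructor
  · exact fun hK => hX' (hK.2 .unit (.refl _)) (.parUnit K)
  · refine fun hK => ⟨fun x hx => (h x hx K hK).trans (.parComm _ _), fun y hy => ?_⟩
    exact hX' hK ((Derives.parUnitSymm K).trans ((Derives.refl K).par hy))

theorem resSet_assoc {X X' Y Y' Z Z' : Set (Formula 𝒜)} (hX : IsUp X') (hY : IsUp Y')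
    (hZ : IsUp Z') :
    resSet (parSet X Y) (resSet X X' Y Y') Z Z' =
      resSet X X' (parSet Y Z) (resSet Y Y' Z Z') := by
  have swap : ∀ K x y : Formula 𝒜, Derives (.par (.par K x) y) (.par (.par K y) x) := fun K x y =>
    (Derives.parAssoc _ _ _).trans
      (((Derives.refl K).par (.parComm x y)).trans (.parAssocSymm _ _ _))
  ext K
  constructor
  · rintro ⟨h1, h2⟩
    refine ⟨fun x hx => ⟨fun y hy => ?_, fun z hz => hY ((h2 z hz).1 x hx) (swap _ _ _)⟩, ?_⟩
    · exact hZ (h1 _ ⟨x, hx, y, hy, .refl _⟩) (.parAssocSymm _ _ _)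
    · rintro w ⟨y, hy, z, hz, h⟩
      exact hX ((h2 z hz).2 y hy) ((swap _ _ _).trans
        ((Derives.parAssoc _ _ _).trans ((Derives.refl K).par h)))
  · rintro ⟨h1, h2⟩
    refine ⟨?_, fun z hz => ⟨fun x hx => hY ((h1 x hx).2 z hz) (swap _ _ _), fun y hy => ?_⟩⟩
    · rintro w ⟨x, hx, y, hy, h⟩
      exact hZ ((h1 x hx).1 y hy) ((Derives.parAssoc _ _ _).trans ((Derives.refl K).par h))
    · exact hX (h2 _ ⟨y, hy, z, hz, .refl _⟩)
        ((Derives.parAssocSymm _ _ _).trans (swap _ _ _))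

/-- This is `q↓` as an interchange law; the next lemma is its counterpart for residuals, and
together they give soundness of `q↓` on both parts of a pair. -/
theorem parSet_seqSet_subset (X Y Z W : Set (Formula 𝒜)) :
    parSet (seqSet X Y) (seqSet Z W) ⊆ seqSet (parSet X Z) (parSet Y W) := by
  rintro K ⟨_, ⟨x, hx, y, hy, h⟩, _, ⟨z, hz, w, hw, h'⟩, k⟩
  exact ⟨_, ⟨x, hx, z, hz, .refl _⟩, _, ⟨y, hy, w, hw, .refl _⟩,
    (Derives.rule (.qDown x z y w)).trans ((h.par h').trans k)⟩

theorem seqSet_resSet_subset (X X' Y Y' Z Z' W W' : Set (Formula 𝒜)) :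
    seqSet (resSet X X' Y Y') (resSet Z Z' W W') ⊆
      resSet (seqSet X Z) (seqSet X' Z') (seqSet Y W) (seqSet Y' W') := by
  rintro K ⟨u, hu, v, hv, h⟩
  constructor
  · rintro _ ⟨x, hx, z, hz, k⟩
    exact ⟨_, hu.1 x hx, _, hv.1 z hz, (Derives.rule (.qDown u x v z)).trans (h.par k)⟩
  · rintro _ ⟨y, hy, w, hw, k⟩
    exact ⟨_, hu.2 y hy, _, hv.2 w hw, (Derives.rule (.qDown u y v w)).trans (h.par k)⟩

/-- Switch in the model; the second inclusion of the Chu morphism follows by duality. -/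
theorem parSet_resSet_subset {X X' Y Y' Z Z' : Set (Formula 𝒜)}
    (hZ : IsUp Z) : parSet X (resSet Y' Y Z' Z) ⊆ resSet (resSet X X' Y Y') (parSet X Y) Z' Z := by
  rintro K ⟨x, hx, w, hw, k⟩
  constructor
  · intro v hv
    refine hZ (hw.1 _ (hv.1 x hx)) ?_
    refine Derives.trans ?_ (k.par (.refl v))
    exact ((Derives.refl w).par (.parComm _ _)).trans ((Derives.parAssocSymm _ _ _).trans
      ((Derives.parComm _ _).par (.refl v)))
  · intro z hz
    exact ⟨x, hx, _, hw.2 z hz, (Derives.parAssocSymm _ _ _).trans (k.par (.refl z))⟩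

theorem isOrth_den (A : Formula 𝒜) : IsOrth A.posDen A.negDen := derives_par_of_mem_den A

theorem isOrth_den_symm (A : Formula 𝒜) : IsOrth A.negDen A.posDen :=
  fun x hx y hy => (derives_par_of_mem_den A y hy x hx).trans (.parComm _ _)

-- Soundness of the interpretation and splitting without flows

theorem EqAx.den_eq {A B : Formula 𝒜} (e : EqAx A B) :
    A.posDen = B.posDen ∧ A.negDen = B.negDen := by
  cases e with
  | tensAssoc A B C =>
    exact ⟨parSet_assoc _ _ _, resSet_assoc (isUp_den A).2 (isUp_den B).2 (isUp_den C).2⟩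
  | tensComm A B =>
    exact ⟨(parSet_comm _ _).antisymm (parSet_comm _ _),
      (resSet_comm _ _ _ _).antisymm (resSet_comm _ _ _ _)⟩
  | tensUnit => exact ⟨parSet_provable (isUp_den B).1, resSet_provable (isUp_den B).2 (isOrth_den B)⟩
  | parAssoc A B C =>
    exact ⟨resSet_assoc (isUp_den A).1 (isUp_den B).1 (isUp_den C).1, parSet_assoc _ _ _⟩
  | parComm A B =>
    exact ⟨(resSet_comm _ _ _ _).antisymm (resSet_comm _ _ _ _),
      (parSet_comm _ _).antisymm (parSet_comm _ _)⟩
  | parUnit =>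
    exact ⟨resSet_provable (isUp_den B).1 (isOrth_den_symm B), parSet_provable (isUp_den B).2⟩
  | seqAssoc A B C => exact ⟨seqSet_assoc _ _ _, seqSet_assoc _ _ _⟩
  | seqUnitRight => exact ⟨seqSet_provable (isUp_den B).1, seqSet_provable (isUp_den B).2⟩
  | seqUnitLeft => exact ⟨provable_seqSet (isUp_den B).1, provable_seqSet (isUp_den B).2⟩

theorem Rule.den_subset {A B : Formula 𝒜} (r : Rule A B) :
    A.posDen ⊆ B.posDen ∧ B.negDen ⊆ A.negDen := by
  cases r with
  | equiv e => exact ⟨e.den_eq.1.subset, e.den_eq.2.symm.subset⟩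
  | equivSymm e => exact ⟨e.den_eq.1.symm.subset, e.den_eq.2.subset⟩
  | aiDown a =>
    refine ⟨fun K hK => ⟨fun x hx => ?_, fun y hy => ?_⟩, ?_⟩
    · change Derives _ _
      have hx : Derives _ _ := hx
      -- Double dualization computes only once the sign of the literal is known.
      cases a <;> exact (Derives.unitParSymm _).trans (Derives.par hK hx)
    · have hy : Derives _ _ := hy
      exact (Derives.unitParSymm _).trans (Derives.par hK hy)
    · rintro K ⟨x, hx, y, hy, h⟩
      exact (Derives.rule (.aiDown a)).trans ((Derives.par hx hy).trans h)
  | switch A B C =>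
    refine ⟨parSet_resSet_subset (isUp_den C).1, ?_⟩
    -- Switch is self-dual: exchanging `A` with `C` and positive with negative parts turns this
    -- inclusion into the one above, up to commutativity.
    refine (parSet_comm _ _).trans ((parSet_mono subset_rfl (resSet_comm _ _ _ _)).trans ?_)
    refine (parSet_resSet_subset (X' := C.posDen) (isUp_den A).2).trans ?_
    refine (resSet_comm _ _ _ _).trans (resSet_mono subset_rfl subset_rfl ?_ (parSet_comm _ _))
    exact resSet_comm _ _ _ _
  | qDown A B C D => exact ⟨seqSet_resSet_subset .., parSet_seqSet_subset ..⟩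

theorem Deriv.den_subset {A B : Formula 𝒜} (Φ : Deriv A B) :
    A.posDen ⊆ B.posDen ∧ B.negDen ⊆ A.negDen := by
  induction Φ with
  | form A => exact ⟨subset_rfl, subset_rfl⟩
  | par Φ Ψ h h' => exact ⟨resSet_mono h.2 h.1 h'.2 h'.1, parSet_mono h.2 h'.2⟩
  | seq Φ Ψ h h' => exact ⟨seqSet_mono h.1 h'.1, seqSet_mono h.2 h'.2⟩
  | tens Φ Ψ h h' => exact ⟨parSet_mono h.1 h'.1, resSet_mono h.1 h.2 h'.1 h'.2⟩
  | step Φ r Ψ h h' =>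
    exact ⟨h.1.trans (r.den_subset.1.trans h'.1), h'.2.trans (r.den_subset.2.trans h.2)⟩

/-- A provable par puts the right component into the denotation of the left one. -/
theorem Deriv.mem_posDen {A K : Formula 𝒜} (Φ : Proof (.par A K)) : K ∈ A.posDen :=
  -- The unit lies in its own positive part, hence in that of `A ⅋ K`. The residual is then tested
  -- at `K`, a member of its own negative part.
  (isUp_den A).1 ((Φ.den_subset.1 (Derives.refl _)).2 K (mem_negDen_self K)) (.unitPar K)

/-- Membership of `K` in the positive part of a tensor is by definition a derivation from a par of
members of the two positive parts. -/
theorem splitting_tens {A B K : Formula 𝒜} (Φ : Proof (.par (.tens A B) K)) :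
    ∃ K₁ K₂, Derives (.par K₁ K₂) K ∧ Derives .unit (.par A K₁) ∧ Derives .unit (.par B K₂) := by
  obtain ⟨x, hx, y, hy, h⟩ := Φ.mem_posDen
  exact ⟨x, y, h, derives_par_of_mem_posDen hx, derives_par_of_mem_posDen hy⟩

theorem splitting_seq {A B K : Formula 𝒜} (Φ : Proof (.par (.seq A B) K)) :
    ∃ K₁ K₂, Derives (.seq K₁ K₂) K ∧ Derives .unit (.par A K₁) ∧ Derives .unit (.par B K₂) := by
  obtain ⟨x, hx, y, hy, h⟩ := Φ.mem_posDen
  exact ⟨x, y, h, derives_par_of_mem_posDen hx, derives_par_of_mem_posDen hy⟩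

theorem splitting_lit {a : Literal 𝒜} {K : Formula 𝒜} (Φ : Proof (.par (.lit a) K)) :
    Derives (.lit a.dual) K :=
  Φ.mem_posDen

/-! ### Uniqueness of flows without cups -/

namespace FlowTerm

variable {p q s t p' q' s' t' v w : List (Literal 𝒜)}

/-- Vertical composition along an equality of strings. -/
def comp (φ : FlowTerm p q) (ψ : FlowTerm q' s) (h : q = q' := by simp) : FlowTerm p s :=
  .vcomp φ (h.symm ▸ ψ)

/-- A wire is inserted behind the string `l`. -/
def ins (a : Literal 𝒜) : (l r : List (Literal 𝒜)) → FlowTerm (a :: (l ++ r)) (l ++ a :: r)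
  | [], r => FlowTerm.id (a :: r)
  | b :: l, r =>
      .vcomp (q := b :: a :: (l ++ r)) (.hcomp (.cross a b) (FlowTerm.id (l ++ r)))
        (.hcomp (.wire b) (ins a l r))

end FlowTerm

-- Calculus of composition up to equality of strings

namespace FlowEq

open FlowTerm

variable {p q s t p' q' s' t' v w : List (Literal 𝒜)}

theorem comp_congr {φ : FlowTerm p q} {ψ : FlowTerm q' s} {φ' : FlowTerm p' t} {ψ' : FlowTerm t' s'}
    {h : q = q'} {h' : t = t'} (e : FlowEq φ φ') (e' : FlowEq ψ ψ') :
    FlowEq (φ.comp ψ h) (φ'.comp ψ' h') := by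
  subst h h'
  exact vcongr e e'

theorem comp_assoc {φ : FlowTerm p q} {ψ : FlowTerm q' s} {θ : FlowTerm s' t}
    {h : q = q'} {h' : s = s'} :
    FlowEq ((φ.comp ψ h).comp θ h') (φ.comp (ψ.comp θ h') h) := by
  subst h h'
  exact vassoc ..

theorem id_comp {φ : FlowTerm p q} {h : p' = p} : FlowEq ((FlowTerm.id p').comp φ h) φ := by
  subst h
  exact id_vcomp φ

theorem comp_id {φ : FlowTerm p q} {h : q = q'} : FlowEq (φ.comp (FlowTerm.id q') h) φ := by
  subst h
  exact vcomp_id φ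

/-- Interchange, from a horizontal composition of composites. -/
theorem hcomp_comp {φ : FlowTerm p q} {φ' : FlowTerm q' s} {ψ : FlowTerm p' t}
    {ψ' : FlowTerm t' s'} {h : q = q'} {h' : t = t'} :
    FlowEq (.hcomp (φ.comp φ' h) (ψ.comp ψ' h'))
      ((FlowTerm.hcomp φ ψ).comp (.hcomp φ' ψ') (by rw [h, h'])) := by
  subst h h'
  exact interchange ..

/-- Interchange, from a vertical composition of horizontal ones. -/
theorem comp_hcomp {φ : FlowTerm p q} {φ' : FlowTerm q' s} {ψ : FlowTerm p' t}
    {ψ' : FlowTerm t' s'} (h : q = q') (h' : t = t') {k : q ++ t = q' ++ t'} :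
    FlowEq ((FlowTerm.hcomp φ ψ).comp (.hcomp φ' ψ') k)
      (.hcomp (φ.comp φ' h) (ψ.comp ψ' h')) := hcomp_comp.symm

theorem hcomp_comp_right (φ : FlowTerm p q) {ψ : FlowTerm p' t}
    {ψ' : FlowTerm t' s'} {h' : t = t'} :
    FlowEq (.hcomp φ (ψ.comp ψ' h'))
      ((FlowTerm.hcomp φ ψ).comp (.hcomp (FlowTerm.id q) ψ') (by rw [h'])) :=
  (hcongr (comp_id (h := rfl)).symm (refl _)).trans hcomp_comp

theorem hcomp_comp_left (ψ : FlowTerm p' s) {φ : FlowTerm p t}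
    {φ' : FlowTerm t' q} {h' : t = t'} :
    FlowEq (.hcomp (φ.comp φ' h') ψ)
      ((FlowTerm.hcomp φ ψ).comp (.hcomp φ' (FlowTerm.id s)) (by rw [h'])) :=
  (hcongr (refl _) (comp_id (h := rfl)).symm).trans hcomp_comp

theorem id_hcomp_id (p q : List (Literal 𝒜)) :
    FlowEq (.hcomp (FlowTerm.id p) (FlowTerm.id q)) (FlowTerm.id (p ++ q)) := by
  induction p with
  | nil => exact empty_hcomp _
  | cons a p ih => exact (hassoc ..).trans (hcongr (refl _) ih)

theorem wire_eq_id (a : Literal 𝒜) : FlowEq (.wire a) (FlowTerm.id [a]) := (hcomp_empty _).symm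

theorem of_eq {p : List (Literal 𝒜)} (h : p = q) : FlowEq (FlowTerm.id p) (FlowTerm.id q) := by
  subst h
  exact refl _

theorem idOf_eq (h : p = q) : FlowEq (FlowTerm.idOf h) (FlowTerm.id p) := by
  subst h
  exact refl _

theorem ins_congr (a : Literal 𝒜) {l l' r r' : List (Literal 𝒜)} (h : l = l') (h' : r = r') :
    FlowEq (FlowTerm.ins a l r) (FlowTerm.ins a l' r') := by
  subst h h'
  exact refl _

/-- The first of two horizontally composed flows may be done before the second. -/
theorem hcomp_slide (φ : FlowTerm p q) (ψ : FlowTerm s t) :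
    FlowEq ((FlowTerm.hcomp φ (FlowTerm.id s)).comp (.hcomp (FlowTerm.id q) ψ) rfl)
      (.hcomp φ ψ) :=
  (comp_hcomp rfl rfl).trans (hcongr comp_id id_comp)

theorem hcomp_slide' (φ : FlowTerm p q) (ψ : FlowTerm s t) :
    FlowEq ((FlowTerm.hcomp (FlowTerm.id p) ψ).comp (.hcomp φ (FlowTerm.id t)) rfl)
      (.hcomp φ ψ) :=
  (comp_hcomp rfl rfl).trans (hcongr id_comp comp_id)

theorem wire_hcomp_comp (a : Literal 𝒜) {φ : FlowTerm p q} {ψ : FlowTerm q' s} {h : q = q'} :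
    FlowEq (.hcomp (.wire a) (φ.comp ψ h))
      ((FlowTerm.hcomp (.wire a) φ).comp (.hcomp (.wire a) ψ) (by rw [h])) :=
  (hcomp_comp_right _).trans (comp_congr (refl _) (hcongr (wire_eq_id a).symm (refl _)))

theorem wire_comp_wire (a : Literal 𝒜) {φ : FlowTerm p q} {ψ : FlowTerm q' s} {h : q = q'}
    {k : [a] ++ q = [a] ++ q'} :
    FlowEq ((FlowTerm.hcomp (.wire a) φ).comp (.hcomp (.wire a) ψ) k)
      (.hcomp (.wire a) (φ.comp ψ h)) := (wire_hcomp_comp a).symm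

theorem ins_cons (a b : Literal 𝒜) (l r : List (Literal 𝒜)) :
    FlowEq (ins a (b :: l) r) ((FlowTerm.hcomp (.cross a b) (FlowTerm.id (l ++ r))).comp
      (.hcomp (.wire b) (ins a l r)) rfl) := refl _

theorem ins_hcomp_id (a : Literal 𝒜) (l r s : List (Literal 𝒜)) :
    FlowEq (.hcomp (ins a l r) (FlowTerm.id s)) (ins a l (r ++ s)) := by
  induction l with
  | nil => exact id_hcomp_id _ _
  | cons b l ih =>
    refine (hcomp_comp_left (h' := rfl) _).trans (comp_congr (h' := rfl) ?_ ?_)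
    · exact (hassoc ..).trans (hcongr (refl _) ((id_hcomp_id _ _).trans (of_eq (by simp))))
    · exact (hassoc ..).trans (hcongr (refl _) ih)

/-- Crossing a concatenation is crossing its two pieces in turn; this reduces horizontal composites
to their factors. -/
theorem ins_append (a : Literal 𝒜) (p l r : List (Literal 𝒜)) :
    FlowEq (ins a (p ++ l) r)
      ((ins a p (l ++ r)).comp (.hcomp (FlowTerm.id p) (ins a l r)) rfl) := by
  induction p with
  | nil => exact (id_comp.trans (empty_hcomp _)).symm
  | cons b p ih =>
    refine (ins_cons a b (p ++ l) r).trans ((comp_congr (h' := rfl)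
      (hcongr (refl _) (of_eq (List.append_assoc p l r))) ((hcongr (refl _) ih).trans (wire_hcomp_comp b))).trans ?_)
    refine comp_assoc.symm.trans (comp_congr (refl _) ?_)
    exact (hassoc ..).symm

end FlowEq

/-- Flows built without cups. -/
inductive CupFree : {p q : List (Literal 𝒜)} → FlowTerm p q → Prop
  | empty : CupFree .empty
  | wire (a : Literal 𝒜) : CupFree (.wire a)
  | cross (a b : Literal 𝒜) : CupFree (.cross a b)
  | cap (a : Literal 𝒜) : CupFree (.cap a)
  | vcomp {p q s : List (Literal 𝒜)} {φ : FlowTerm p q} {ψ : FlowTerm q s} :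
      CupFree φ → CupFree ψ → CupFree (.vcomp φ ψ)
  | hcomp {p q s t : List (Literal 𝒜)} {φ : FlowTerm p q} {ψ : FlowTerm s t} :
      CupFree φ → CupFree ψ → CupFree (.hcomp φ ψ)

namespace CupFree

open FlowTerm

variable {p q s t p' q' s' t' v w : List (Literal 𝒜)}

theorem id (p : List (Literal 𝒜)) : CupFree (FlowTerm.id p) := by
  induction p with
  | nil => exact .empty
  | cons a p ih => exact .hcomp (.wire a) ih

theorem idOf (h : p = q) : CupFree (FlowTerm.idOf h) := by
  subst h
  exact id p

end CupFree

-- Sliding wires and caps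

open FlowTerm FlowEq

variable {p q s t p' q' s' t' v w : List (Literal 𝒜)}

theorem FlowEq.cross_comp_cross (a b : Literal 𝒜) :
    FlowEq ((FlowTerm.cross a b).comp (.cross b a) rfl) (FlowTerm.id [a, b]) :=
  FlowEq.cross_cross a b

theorem FlowEq.ins_single (a b : Literal 𝒜) : FlowEq (ins a [b] []) (.cross a b) :=
  (comp_id (h := rfl)).trans (hcomp_empty _)

theorem FlowEq.ins_pair (a b c : Literal 𝒜) :
    FlowEq (ins a [b, c] []) ((FlowTerm.hcomp (.cross a b) (.wire c)).comp
      (.hcomp (.wire b) (.cross a c)) rfl) :=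
  comp_congr (h := rfl) (hcongr (refl _) (wire_eq_id c).symm) (hcongr (refl _) (ins_single a c))

/-- Naturality of `ins` follows from its case without further wires. -/
theorem FlowEq.ins_natural_of {φ : FlowTerm p q} {a : Literal 𝒜}
    (hφ : FlowEq ((ins a p []).comp (.hcomp φ (.wire a)) rfl)
      ((FlowTerm.hcomp (.wire a) φ).comp (ins a q [])))
    {r r' : List (Literal 𝒜)} (θ : FlowTerm r r') :
    FlowEq ((ins a p r).comp (.hcomp φ (.hcomp (.wire a) θ)) rfl)
      ((FlowTerm.hcomp (.wire a) (.hcomp φ θ)).comp (ins a q r') rfl) :=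
  (comp_congr (h' := by simp) (ins_hcomp_id a p [] r).symm (hassoc ..).symm).trans <|
    (comp_hcomp rfl rfl).trans <| (hcongr hφ (id_comp.trans comp_id.symm)).trans <|
      (hcomp_comp (h' := rfl)).trans <| comp_congr (hassoc ..) (ins_hcomp_id a q [] r')

/-- Induction on the flow. For a crossing this is Yang–Baxter; for a cap it is `cap_slide` followed
by the cancellation of two opposite crossings. -/
theorem CupFree.ins_natural_wire {φ : FlowTerm p q} (hφ : CupFree φ) (a : Literal 𝒜) :
    FlowEq ((ins a p []).comp (.hcomp φ (.wire a)) rfl)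
      ((FlowTerm.hcomp (.wire a) φ).comp (ins a q [])) := by
  induction hφ with
  | empty => exact id_comp.trans ((empty_hcomp _).trans ((comp_id).trans (hcomp_empty _)).symm)
  | wire b =>
    refine FlowEq.trans (comp_congr (h' := rfl) (ins_single a b) (hcongr (refl _) (wire_eq_id a)))
      (comp_id.trans ?_)
    refine FlowEq.symm (FlowEq.trans (comp_congr (h' := rfl) (hcongr (refl _) (wire_eq_id b))
      (ins_single a b)) id_comp)
  | cross b c =>
    refine (comp_congr (h' := rfl) (ins_pair a b c) (refl _)).trans (comp_assoc.trans ?_)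
    exact (yangBaxter a b c).trans (comp_congr (h := rfl) (refl _) (ins_pair a c b).symm)
  | cap b =>
    refine id_comp.trans (FlowEq.symm ?_)
    refine (comp_congr (h' := rfl) (refl _) (ins_pair a b b.dual)).trans (comp_assoc.symm.trans ?_)
    refine (comp_congr (h' := rfl) (cap_slide b a).symm (refl _)).trans ((vassoc ..).trans ?_)
    refine (comp_congr (h := rfl) (h' := rfl) (refl _)
      ((wire_comp_wire (h := rfl) (k := rfl) b).trans (hcongr (refl _) (cross_comp_cross b.dual a)))).trans ?_
    exact comp_id
  | @vcomp p q s φ ψ h1 h2 ih1 ih2 =>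
    refine (comp_congr (h' := rfl) (refl _) (hcomp_comp_left (h' := rfl) _)).trans ?_
    refine comp_assoc.symm.trans ((comp_congr (h' := rfl) ih1
      (hcongr (refl ψ) (wire_eq_id a).symm)).trans ?_)
    refine comp_assoc.trans ((comp_congr (h' := by simp) (refl _) ih2).trans ?_)
    exact comp_assoc.symm.trans (comp_congr (wire_comp_wire (h := rfl) a) (refl _))
  | @hcomp p q s t φ ψ h1 h2 ih1 ih2 =>
    refine (comp_congr (h' := rfl) (ins_append a p s []) (hassoc ..)).trans ?_
    refine comp_assoc.trans ?_
    refine FlowEq.trans (comp_congr (h' := by simp) (refl _) (comp_hcomp rfl rfl)) ?_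
    refine FlowEq.trans (comp_congr (h' := by simp) (refl _) (hcongr id_comp ih2)) ?_
    refine (comp_congr (h' := by simp) (ins_congr a (l' := p) (r' := s) rfl (by simp))
      (hcomp_comp_right _)).trans ?_
    refine comp_assoc.symm.trans ((comp_congr (h' := by simp) (ins_natural_of ih1 ψ)
      (refl _)).trans (comp_assoc.trans (comp_congr (refl _) ?_)))
    exact (comp_congr (ins_congr a rfl (by simp)) (refl _)).trans (ins_append a q t []).symm

/-- A wire slides across a flow without cups. -/
theorem CupFree.ins_natural {φ : FlowTerm p q} (hφ : CupFree φ) (a : Literal 𝒜)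
    {r r' : List (Literal 𝒜)} (θ : FlowTerm r r') :
    FlowEq ((ins a p r).comp (.hcomp φ (.hcomp (.wire a) θ)) rfl)
      ((FlowTerm.hcomp (.wire a) (.hcomp φ θ)).comp (ins a q r') rfl) :=
  ins_natural_of (hφ.ins_natural_wire a) θ

/-- A cap slides across a string. -/
theorem FlowEq.cap_natural (a : Literal 𝒜) (q w : List (Literal 𝒜)) :
    FlowEq (.hcomp (FlowTerm.id q) (.hcomp (.cap a) (FlowTerm.id w)))
      (((FlowTerm.hcomp (.cap a) (FlowTerm.id (q ++ w))).comp
        (.hcomp (.wire a) (ins a.dual q w)) rfl).comp (ins a q (a.dual :: w)) rfl) := by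
  induction q with
  | nil =>
    refine (empty_hcomp _).trans (FlowEq.symm ?_)
    exact comp_id.trans comp_id
  | cons b q ih =>
    have slide : FlowEq (.hcomp (.wire b) (.cap a)) ((((FlowTerm.hcomp (.cap a) (.wire b))).comp
        (.hcomp (.wire a) (.cross a.dual b)) rfl).comp (.hcomp (.cross a b) (.wire a.dual)) rfl) := by
      refine FlowEq.symm ((comp_congr (h' := rfl) (cap_slide a b) (refl _)).trans ?_)
      refine FlowEq.trans (vassoc ..) ?_
      refine (comp_congr (h := rfl) (h' := rfl) (refl _) ?_).trans comp_id
      refine (comp_hcomp (φ := .cross b a) (φ' := .cross a b) (ψ := .wire a.dual) rfl rfl (k := rfl)).trans ?_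
      exact (hcongr (cross_comp_cross b a) ((comp_congr (h' := rfl) (refl _) (wire_eq_id _)).trans
        (comp_id.trans (wire_eq_id _)))).trans (id_hcomp_id [b, a] [a.dual])
    have hA : FlowEq (.hcomp (.hcomp (.cap a) (.wire b)) (FlowTerm.id (q ++ w)))
        (.hcomp (.cap a) (FlowTerm.id (b :: q ++ w))) := hassoc ..
    have hB : FlowEq (.hcomp (.hcomp (.wire a) (.cross a.dual b)) (FlowTerm.id (q ++ w)))
        (.hcomp (.wire a) (.hcomp (.cross a.dual b) (FlowTerm.id (q ++ w)))) := hassoc ..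
    have hC : FlowEq (.hcomp (.hcomp (.cross a b) (.wire a.dual)) (FlowTerm.id (q ++ w)))
        (.hcomp (.cross a b) (FlowTerm.id (a.dual :: (q ++ w)))) := hassoc ..
    -- The crossing and the insertion act on disjoint wires, so they may be interchanged.
    have hD : FlowEq
        (FlowTerm.comp (.hcomp (.cross a b) (FlowTerm.id (a.dual :: (q ++ w))))
          (.hcomp (.wire b) (.hcomp (.wire a) (ins a.dual q w))) rfl)
        (FlowTerm.comp (.hcomp (.wire a) (.hcomp (.wire b) (ins a.dual q w)))
          (.hcomp (.cross a b) (FlowTerm.id (q ++ a.dual :: w))) rfl) := by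
      have e : ∀ c d : Literal 𝒜, FlowEq (.hcomp (.wire c) (.hcomp (.wire d) (ins a.dual q w)))
          (.hcomp (FlowTerm.id [c, d]) (ins a.dual q w)) := fun c d =>
        (hassoc ..).symm.trans (hcongr (hcongr (refl _) (wire_eq_id d)) (refl _))
      refine FlowEq.trans (comp_congr (h' := rfl) (refl _) (e b a)) ?_
      refine (hcomp_slide ..).trans ((hcomp_slide' ..).symm.trans ?_)
      exact comp_congr (e a b).symm (refl _)
    have hABC := ((hassoc ..).symm.trans (hcongr slide (refl (FlowTerm.id (q ++ w))))).trans
      ((hcomp_comp_left (h' := rfl) _).trans (comp_congr (h' := rfl)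
        ((hcomp_comp_left (h' := rfl) _).trans (comp_congr (h' := rfl) hA hB)) hC))
    refine (hassoc ..).trans ((hcongr (refl _) ih).trans ?_)
    refine (wire_hcomp_comp b).trans ?_
    refine FlowEq.trans (comp_congr (h' := rfl) (wire_hcomp_comp b) (refl _)) ?_
    refine FlowEq.trans (comp_congr (h' := rfl) (comp_congr (h' := rfl) hABC (refl _)) (refl _)) ?_
    refine FlowEq.trans (comp_congr (h' := rfl) comp_assoc (refl _)) ?_
    refine FlowEq.trans (comp_congr (h' := rfl) (comp_congr (h' := rfl) (refl _) hD) (refl _)) ?_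
    refine FlowEq.trans (comp_congr (h' := rfl) comp_assoc.symm (refl _)) ?_
    refine FlowEq.trans comp_assoc (comp_congr (h' := rfl) ?_ (refl _))
    refine FlowEq.trans comp_assoc (comp_congr (h' := rfl) (refl _) ?_)
    exact wire_comp_wire (h := rfl) a

/-- `φ` carries its input wire `a` behind `p₁` to its output wire behind `q₁`, and becomes `φ'` when
that wire is removed. -/
def Traces (a : Literal 𝒜) (p₁ p₂ q₁ q₂ : List (Literal 𝒜)) (φ : FlowTerm p q)
    (φ' : FlowTerm p' q') : Prop :=
  ∃ (hp : p = p₁ ++ a :: p₂) (_ : q = q₁ ++ a :: q₂) (_ : p' = p₁ ++ p₂) (hq' : q' = q₁ ++ q₂),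
    FlowEq ((ins a p₁ p₂).comp φ hp.symm)
      ((FlowTerm.hcomp (.wire a) φ').comp (ins a q₁ q₂) (by rw [hq']; rfl))

theorem Traces.vcomp {a : Literal 𝒜} {p₁ p₂ q₁ q₂ s₁ s₂ : List (Literal 𝒜)} {φ : FlowTerm p q}
    {φ' : FlowTerm p' q'} {ψ : FlowTerm q s} {ψ' : FlowTerm q' s'}
    (h : Traces a p₁ p₂ q₁ q₂ φ φ') (k : Traces a q₁ q₂ s₁ s₂ ψ ψ') :
    Traces a p₁ p₂ s₁ s₂ (.vcomp φ ψ) (.vcomp φ' ψ') := by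
  obtain ⟨rfl, rfl, rfl, rfl, h⟩ := h
  obtain ⟨_, rfl, _, rfl, k⟩ := k
  refine ⟨rfl, rfl, rfl, rfl, ?_⟩
  refine (comp_assoc (ψ := φ) (θ := ψ) (h' := rfl)).symm.trans ?_
  refine FlowEq.trans (comp_congr (h' := rfl) h (refl _)) ?_
  refine FlowEq.trans comp_assoc ?_
  refine FlowEq.trans (comp_congr (h' := rfl) (refl _) k) ?_
  exact comp_assoc.symm.trans (comp_congr (h := rfl) (wire_comp_wire (h := rfl) a) (refl _))

theorem Traces.hcomp_left {a : Literal 𝒜} {p₁ p₂ q₁ q₂ : List (Literal 𝒜)} {φ : FlowTerm p q}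
    {φ' : FlowTerm p' q'} (h : Traces a p₁ p₂ q₁ q₂ φ φ') (ψ : FlowTerm s t) :
    Traces a p₁ (p₂ ++ s) q₁ (q₂ ++ t) (.hcomp φ ψ) (.hcomp φ' ψ) := by
  obtain ⟨rfl, rfl, rfl, rfl, h⟩ := h
  refine ⟨by simp, by simp, by simp, by simp, ?_⟩
  refine FlowEq.trans (comp_congr (h' := rfl) (ins_hcomp_id a p₁ p₂ s).symm (refl _)) ?_
  refine FlowEq.trans (comp_hcomp rfl rfl) ?_
  refine FlowEq.trans (hcongr h (id_comp.trans (comp_id (h := rfl)).symm)) ?_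
  refine FlowEq.trans (hcomp_comp (h' := rfl)) ?_
  exact comp_congr (hassoc ..) (ins_hcomp_id a q₁ q₂ t)

/-- The traced wire is pulled to the far left and so has to pass across `φ`; this is where `φ` must
be cup-free. -/
theorem Traces.hcomp_right {a : Literal 𝒜} {s₁ s₂ t₁ t₂ : List (Literal 𝒜)} {φ : FlowTerm p q}
    (hφ : CupFree φ) {ψ : FlowTerm s t} {ψ' : FlowTerm s' t'} (h : Traces a s₁ s₂ t₁ t₂ ψ ψ') :
    Traces a (p ++ s₁) s₂ (q ++ t₁) t₂ (.hcomp φ ψ) (.hcomp φ ψ') := by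
  obtain ⟨rfl, rfl, rfl, rfl, h⟩ := h
  refine ⟨by simp, by simp, by simp, by simp, ?_⟩
  refine FlowEq.trans (comp_congr (h' := rfl) (ins_append a p s₁ s₂) (refl _)) ?_
  refine FlowEq.trans comp_assoc ?_
  refine FlowEq.trans (comp_congr (h' := rfl) (refl _) (comp_hcomp rfl rfl)) ?_
  refine FlowEq.trans (comp_congr (h' := rfl) (refl _) (hcongr id_comp h)) ?_
  refine FlowEq.trans (comp_congr (h' := rfl) (refl _) (hcomp_comp_right _)) ?_
  refine FlowEq.trans comp_assoc.symm ?_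
  refine FlowEq.trans (comp_congr (h' := rfl) (hφ.ins_natural a ψ') (refl _)) ?_
  refine FlowEq.trans comp_assoc (comp_congr (refl _) ?_)
  exact (ins_append a q t₁ t₂).symm

/-- `φ` is `φ'` with a cap inserted that ends in the wire `a` behind `q₁`; the other end of the cap
is behind `l` in the string without `a`. -/
def FromCap (a : Literal 𝒜) (q₁ q₂ l r : List (Literal 𝒜)) (φ : FlowTerm p q)
    (φ' : FlowTerm p' q') : Prop :=
  ∃ (_ : p' = p) (_ : q = q₁ ++ a :: q₂) (h : q₁ ++ q₂ = l ++ a.dual :: r) (hq' : q' = l ++ r),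
    FlowEq φ (((FlowTerm.hcomp (.cap a) φ').comp (.hcomp (.wire a) (ins a.dual l r))
      (by rw [hq']; rfl)).comp (ins a q₁ q₂) (by rw [h]; rfl))

theorem FlowEq.wire_wire_hcomp (a b : Literal 𝒜) (φ : FlowTerm p q) :
    FlowEq (.hcomp (.wire a) (.hcomp (.wire b) φ)) (.hcomp (FlowTerm.id [a, b]) φ) :=
  (hassoc ..).symm.trans (hcongr (hcongr (refl _) (wire_eq_id b)) (refl _))

/-- Both ends of the cap continue through `ψ`. Removing the wire `a` turns `ψ` into `ψ'`, and
removing the other end from `ψ'` leaves `ψ''`. -/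
theorem FromCap.vcomp {a : Literal 𝒜} {q₁ q₂ l r s₁ s₂ l' r' : List (Literal 𝒜)}
    {φ : FlowTerm p q} {φ' : FlowTerm p' q'} {ψ : FlowTerm q s} {ψ' : FlowTerm t w}
    {ψ'' : FlowTerm q' s'}
    (h : FromCap a q₁ q₂ l r φ φ') (k : Traces a q₁ q₂ s₁ s₂ ψ ψ')
    (k' : Traces a.dual l r l' r' ψ' ψ'') :
    FromCap a s₁ s₂ l' r' (.vcomp φ ψ) (.vcomp φ' ψ'') := by
  obtain ⟨rfl, rfl, h0, rfl, h⟩ := h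
  obtain ⟨_, rfl, rfl, rfl, k⟩ := k
  obtain ⟨k0, k1, _, rfl, k'⟩ := k'
  refine ⟨rfl, rfl, k1, rfl, ?_⟩
  refine (comp_congr (h := rfl) (h' := rfl) h (refl ψ)).trans ?_
  refine FlowEq.trans comp_assoc (FlowEq.trans (comp_congr (h' := by simp [h0]) (refl _) k) ?_)
  refine FlowEq.trans comp_assoc.symm (comp_congr ?_ (refl _))
  refine FlowEq.trans comp_assoc ?_
  have e := hcongr (FlowEq.refl (FlowTerm.wire a)) k'
  refine FlowEq.trans (comp_congr (h' := by rfl) (FlowEq.refl _)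
    ((wire_comp_wire (h := k0.symm) a).trans e)) ?_
  refine FlowEq.trans (comp_congr (h' := rfl) (refl _) (wire_hcomp_comp a)) ?_
  refine FlowEq.trans comp_assoc.symm (comp_congr ?_ (refl _))
  refine FlowEq.trans (comp_congr (h' := rfl) (refl _) (wire_wire_hcomp ..)) ?_
  exact (comp_hcomp rfl rfl).trans (hcongr comp_id (refl _))

theorem FromCap.hcomp_left {a : Literal 𝒜} {q₁ q₂ l r : List (Literal 𝒜)}
    {φ : FlowTerm p q} {φ' : FlowTerm p' q'} (h : FromCap a q₁ q₂ l r φ φ') (ψ : FlowTerm s t) :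
    FromCap a q₁ (q₂ ++ t) l (r ++ t) (.hcomp φ ψ) (.hcomp φ' ψ) := by
  obtain ⟨rfl, rfl, h0, rfl, h⟩ := h
  refine ⟨rfl, by simp, by rw [← List.append_assoc, h0]; simp, by simp, ?_⟩
  refine (hcongr h (refl ψ)).trans ((hcomp_comp_left _).trans ?_)
  refine comp_congr ((hcomp_comp_left _).trans ?_) (ins_hcomp_id a q₁ q₂ t)
  exact comp_congr (hassoc ..) ((hassoc ..).trans (hcongr (refl _) (ins_hcomp_id ..)))

/-- A cap has no inputs, so it can be created after `φ` and then moved left across the outputs `t`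
by `cap_natural`; `φ` itself is never crossed. -/
theorem FromCap.hcomp_right {a : Literal 𝒜} {q₁ q₂ l r : List (Literal 𝒜)}
    {ψ : FlowTerm p q} {ψ' : FlowTerm p' q'} (h : FromCap a q₁ q₂ l r ψ ψ') (φ : FlowTerm s t) :
    FromCap a (t ++ q₁) q₂ (t ++ l) r (.hcomp φ ψ) (.hcomp φ ψ') := by
  obtain ⟨rfl, rfl, h0, rfl, h⟩ := h
  refine ⟨rfl, by simp, by simp [h0], by simp, ?_⟩
  refine (hcongr (refl φ) h).trans ((hcomp_comp_right _).trans ?_)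
  refine FlowEq.trans (comp_congr (h' := by simp [h0]) (hcomp_comp_right _) (refl _)) ?_
  have e : FlowEq (.hcomp φ (.hcomp (.cap a) ψ'))
      (((FlowTerm.hcomp (.cap a) (.hcomp φ ψ')).comp
        (.hcomp (.wire a) (ins a.dual t (l ++ r))) rfl).comp
          (ins a t (a.dual :: (l ++ r))) rfl) := by
    have e1 : FlowEq (.hcomp (.cap a) ψ')
        (ψ'.comp (.hcomp (.cap a) (FlowTerm.id (l ++ r))) rfl) :=
      (hcomp_slide' ..).symm.trans (comp_congr (empty_hcomp _) (refl _))
    have e2 : FlowEq ((FlowTerm.hcomp φ ψ').comp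
        (.hcomp (.cap a) (FlowTerm.id (t ++ (l ++ r)))) rfl) (.hcomp (.cap a) (.hcomp φ ψ')) :=
      FlowEq.trans (comp_congr (h' := rfl) (empty_hcomp _).symm (refl _)) (hcomp_slide' ..)
    refine (hcongr (refl φ) e1).trans ((hcomp_comp_right _).trans ?_)
    refine FlowEq.trans (comp_congr (h' := rfl) (refl _) (cap_natural a t (l ++ r))) ?_
    refine FlowEq.trans comp_assoc.symm (comp_congr ?_ (refl _))
    exact FlowEq.trans comp_assoc.symm (comp_congr e2 (refl _))
  -- The end `a` moves behind `t` before the dual end moves on to its place in `l ++ r`. Naturality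
  -- swaps these two moves, so that each end travels in a single insertion.
  refine FlowEq.trans (comp_congr (h' := by simp [h0]) (comp_congr (h' := rfl) e (refl _)) (refl _)) ?_
  refine FlowEq.trans (comp_congr (h' := by simp [h0]) comp_assoc (refl _)) ?_
  refine FlowEq.trans (comp_congr (h' := by simp [h0]) (comp_congr (h' := rfl) (refl _)
    ((CupFree.id t).ins_natural a (ins a.dual l r))) (refl _)) ?_
  refine FlowEq.trans (comp_congr (h' := by simp [h0]) comp_assoc.symm (refl _)) ?_
  refine FlowEq.trans comp_assoc (comp_congr ?_ ?_)
  · refine FlowEq.trans comp_assoc (comp_congr (refl _) ?_)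
    exact (wire_comp_wire (h := rfl) a).trans (hcongr (refl _) (ins_append ..).symm)
  · exact FlowEq.trans (comp_congr (h' := rfl) (ins_congr a rfl h0.symm) (refl _))
      (ins_append ..).symm

-- Following wires, and uniqueness of the flow

theorem append_eq_append_cons {α : Type*} {q t q₁ q₂ : List α} {a : α}
    (h : q ++ t = q₁ ++ a :: q₂) :
    (∃ u, q = q₁ ++ a :: u ∧ q₂ = u ++ t) ∨ ∃ u, t = u ++ a :: q₂ ∧ q₁ = q ++ u := by
  rcases List.append_eq_append_iff.1 h with ⟨u, rfl, rfl⟩ | ⟨u, rfl, hu⟩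
  · exact .inr ⟨u, rfl, rfl⟩
  · cases u with
    | nil => exact .inr ⟨[], by simpa using hu.symm, by simp⟩
    | cons b u =>
      simp only [List.cons_append, List.cons.injEq] at hu
      obtain ⟨rfl, rfl⟩ := hu
      exact .inl ⟨u, rfl, rfl⟩

theorem Traces.exists_cast {a : Literal 𝒜} {p₁ p₂ q₁ q₂ : List (Literal 𝒜)} {φ : FlowTerm p q}
    {φ' : FlowTerm p' q'} (h : Traces a p₁ p₂ q₁ q₂ φ φ') (hφ : CupFree φ') :
    ∃ φ'' : FlowTerm (p₁ ++ p₂) (q₁ ++ q₂), CupFree φ'' ∧ Traces a p₁ p₂ q₁ q₂ φ φ'' := by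
  obtain ⟨rfl, rfl, rfl, rfl, k⟩ := h
  exact ⟨φ', hφ, rfl, rfl, rfl, rfl, k⟩

theorem FromCap.exists_cast {a : Literal 𝒜} {q₁ q₂ l r : List (Literal 𝒜)} {φ : FlowTerm p q}
    {φ' : FlowTerm p' q'} (h : FromCap a q₁ q₂ l r φ φ') (hφ : CupFree φ') :
    ∃ φ'' : FlowTerm p (l ++ r), CupFree φ'' ∧ FromCap a q₁ q₂ l r φ φ'' := by
  obtain ⟨rfl, h1, h2, rfl, k⟩ := h
  exact ⟨φ', hφ, rfl, h1, h2, rfl, k⟩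

theorem Traces.wire (a : Literal 𝒜) : Traces a [] [] [] [] (FlowTerm.wire a) .empty :=
  ⟨rfl, rfl, rfl, rfl, id_comp.trans (comp_id.trans (hcomp_empty _)).symm⟩

theorem Traces.cross_left (a b : Literal 𝒜) :
    Traces a [] [b] [b] [] (FlowTerm.cross a b) (.wire b) := by
  refine ⟨rfl, rfl, rfl, rfl, id_comp.trans (FlowEq.symm ?_)⟩
  refine FlowEq.trans (comp_congr (h' := rfl) (hcongr (FlowEq.refl (FlowTerm.wire a))
    (wire_eq_id b)) (FlowEq.refl (ins a [b] []))) ?_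
  exact FlowEq.trans id_comp (ins_single a b)

theorem Traces.cross_right (a b : Literal 𝒜) :
    Traces a [b] [] [] [b] (FlowTerm.cross b a) (.wire b) := by
  refine ⟨rfl, rfl, rfl, rfl, ?_⟩
  refine FlowEq.trans (comp_congr (h' := rfl) (ins_single a b) (FlowEq.refl _)) ?_
  refine (cross_comp_cross a b).trans (FlowEq.symm (comp_id.trans ?_))
  exact hcongr (FlowEq.refl _) (wire_eq_id b)

/-- Every input wire of a flow without cups can be pulled out. -/
theorem CupFree.exists_traces_of_src {φ : FlowTerm p q} (hφ : CupFree φ) {a : Literal 𝒜}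
    {p₁ p₂ : List (Literal 𝒜)} (h : p = p₁ ++ a :: p₂) :
    ∃ (q₁ q₂ : List (Literal 𝒜)) (φ' : FlowTerm (p₁ ++ p₂) (q₁ ++ q₂)),
      CupFree φ' ∧ Traces a p₁ p₂ q₁ q₂ φ φ' := by
  induction hφ generalizing p₁ p₂ with
  | empty => simp at h
  | wire b =>
    obtain ⟨rfl, rfl, rfl⟩ : p₁ = [] ∧ a = b ∧ p₂ = [] := by
      rcases p₁ with _ | ⟨_, _⟩ <;> simp_all
    exact ⟨_, _, _, .empty, .wire a⟩
  | cross b c =>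
    rcases p₁ with _ | ⟨d, p₁⟩
    · simp only [List.nil_append, List.cons.injEq] at h
      obtain ⟨rfl, rfl⟩ := h
      exact ⟨_, _, _, .wire c, .cross_left b c⟩
    · obtain ⟨rfl, rfl, rfl, rfl⟩ : b = d ∧ p₁ = [] ∧ a = c ∧ p₂ = [] := by
        rcases p₁ with _ | ⟨_, _⟩ <;> simp_all
      exact ⟨_, _, _, .wire b, .cross_right a b⟩
  | cap b => simp at h
  | vcomp h1 h2 ih1 ih2 =>
    obtain ⟨q₁, q₂, φ', hφ', k⟩ := ih1 h
    obtain ⟨s₁, s₂, ψ', hψ', k'⟩ := ih2 k.2.1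
    exact ⟨s₁, s₂, .vcomp φ' ψ', .vcomp hφ' hψ', k.vcomp k'⟩
  | hcomp h1 h2 ih1 ih2 =>
    rcases append_eq_append_cons h with ⟨u, hu, rfl⟩ | ⟨u, hu, rfl⟩
    · obtain ⟨q₁, q₂, φ', hφ', k⟩ := ih1 hu
      exact ⟨_, _, (k.hcomp_left _).exists_cast (.hcomp hφ' h2)⟩
    · obtain ⟨q₁, q₂, φ', hφ', k⟩ := ih2 hu
      exact ⟨_, _, (k.hcomp_right h1).exists_cast (.hcomp h1 hφ')⟩

theorem FromCap.cap_left (a : Literal 𝒜) :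
    FromCap a [] [a.dual] [] [] (FlowTerm.cap a) .empty :=
  ⟨rfl, rfl, rfl, rfl, (comp_id.trans (comp_id.trans (hcomp_empty _))).symm⟩

/-- The normal form puts the chosen end first, so the cap is rewritten as the dual cap followed by a
crossing. -/
theorem FromCap.cap_right (a : Literal 𝒜) :
    FromCap a.dual [a] [] [] [] (FlowTerm.cap a) .empty := by
  have e : FlowEq ((FlowTerm.cap a.dual).comp (.cross a.dual a) (by cases a <;> rfl))
      (FlowTerm.cap a) := by
    cases a with
    | pos a => exact cap_cross_pos a
    | neg a => exact cap_cross_neg a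
  have d : a.dual.dual = a := by cases a <;> rfl
  refine ⟨rfl, rfl, by rw [d]; rfl, rfl, FlowEq.symm ?_⟩
  refine (comp_congr (h' := by rw [d]) ?_ (ins_single a.dual a)).trans e
  exact comp_id.trans (hcomp_empty _)

/-- Every output wire of a flow without cups comes from an input or from a cap. -/
theorem CupFree.exists_of_tgt {φ : FlowTerm p q} (hφ : CupFree φ) {a : Literal 𝒜}
    {q₁ q₂ : List (Literal 𝒜)} (h : q = q₁ ++ a :: q₂) :
    (∃ (p₁ p₂ : List (Literal 𝒜)) (φ' : FlowTerm (p₁ ++ p₂) (q₁ ++ q₂)),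
      CupFree φ' ∧ Traces a p₁ p₂ q₁ q₂ φ φ') ∨
    ∃ (l r : List (Literal 𝒜)) (φ' : FlowTerm p (l ++ r)),
      CupFree φ' ∧ FromCap a q₁ q₂ l r φ φ' := by
  induction hφ generalizing a q₁ q₂ with
  | empty => simp at h
  | wire b =>
    obtain ⟨rfl, rfl, rfl⟩ : q₁ = [] ∧ a = b ∧ q₂ = [] := by
      rcases q₁ with _ | ⟨_, _⟩ <;> simp_all
    exact .inl ⟨_, _, _, .empty, .wire a⟩
  | cross b c =>
    rcases q₁ with _ | ⟨d, q₁⟩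
    · simp only [List.nil_append, List.cons.injEq] at h
      obtain ⟨rfl, rfl⟩ := h
      exact .inl ⟨_, _, _, .wire b, .cross_right c b⟩
    · obtain ⟨rfl, rfl, rfl, rfl⟩ : c = d ∧ q₁ = [] ∧ a = b ∧ q₂ = [] := by
        rcases q₁ with _ | ⟨_, _⟩ <;> simp_all
      exact .inl ⟨_, _, _, .wire c, .cross_left a c⟩
  | cap b =>
    rcases q₁ with _ | ⟨d, q₁⟩
    · simp only [List.nil_append, List.cons.injEq] at h
      obtain ⟨rfl, rfl⟩ := h
      exact .inr ⟨_, _, _, .empty, .cap_left b⟩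
    · obtain ⟨rfl, rfl, rfl, rfl⟩ : b = d ∧ q₁ = [] ∧ a = b.dual ∧ q₂ = [] := by
        rcases q₁ with _ | ⟨_, _⟩ <;> simp_all [eq_comm]
      exact .inr ⟨_, _, _, .empty, .cap_right b⟩
  | @vcomp p q s φ ψ h1 h2 ih1 ih2 =>
    rcases ih2 h with ⟨s₁, s₂, ψ', hψ', k⟩ | ⟨l, r, ψ', hψ', k⟩
    · rcases ih1 k.1 with ⟨p₁, p₂, φ', hφ', k'⟩ | ⟨l, r, φ', hφ', k'⟩
      · exact .inl ⟨_, _, .vcomp φ' ψ', .vcomp hφ' hψ', k'.vcomp k⟩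
      -- The chosen end leaves through the output of `ψ`; the other end enters `ψ'`, where it can be
      -- pulled out in turn because there are no cups.
      · obtain ⟨l', r', ψ'', hψ'', k''⟩ := hψ'.exists_traces_of_src k'.2.2.1
        exact .inr ⟨_, _, .vcomp φ' ψ'', .vcomp hφ' hψ'', k'.vcomp k k''⟩
    · obtain ⟨_, rfl, e1, _, k⟩ := k
      refine .inr ⟨l, r, .vcomp φ ψ', .vcomp h1 hψ', rfl, rfl, e1, rfl, ?_⟩
      refine (comp_congr (h := rfl) (h' := rfl) (refl φ) k).trans ?_
      refine FlowEq.trans comp_assoc.symm (comp_congr ?_ (refl _))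
      refine FlowEq.trans comp_assoc.symm (comp_congr ?_ (refl _))
      refine FlowEq.trans (comp_congr (h' := rfl) (empty_hcomp φ).symm (refl _)) ?_
      exact (comp_hcomp rfl rfl).trans (hcongr id_comp (refl _))
  | hcomp h1 h2 ih1 ih2 =>
    rcases append_eq_append_cons h with ⟨u, hu, rfl⟩ | ⟨u, hu, rfl⟩
    · rcases ih1 hu with ⟨_, _, φ', hφ', k⟩ | ⟨_, _, φ', hφ', k⟩
      · exact .inl ⟨_, _, (k.hcomp_left _).exists_cast (.hcomp hφ' h2)⟩
      · exact .inr ⟨_, _, (k.hcomp_left _).exists_cast (.hcomp hφ' h2)⟩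
    · rcases ih2 hu with ⟨_, _, φ', hφ', k⟩ | ⟨_, _, φ', hφ', k⟩
      · exact .inl ⟨_, _, (k.hcomp_right h1).exists_cast (.hcomp h1 hφ')⟩
      · exact .inr ⟨_, _, (k.hcomp_right _).exists_cast (.hcomp h1 hφ')⟩

/-- Without cups no wire can end inside the flow, so an empty output excludes wires altogether. -/
theorem CupFree.eq_empty {φ : FlowTerm p q} (hφ : CupFree φ) (h : q = []) :
    p = [] ∧ FlowEq φ (.empty (𝒜 := 𝒜)) := by
  induction hφ with
  | empty => exact ⟨rfl, refl _⟩
  | wire b => simp at h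
  | cross b c => simp at h
  | cap b => simp at h
  | @vcomp p q s φ ψ h1 h2 ih1 ih2 =>
    obtain ⟨rfl, e2⟩ := ih2 h
    obtain ⟨rfl, e1⟩ := ih1 rfl
    exact ⟨rfl, (vcongr e1 e2).trans (id_vcomp _)⟩
  | hcomp h1 h2 ih1 ih2 =>
    obtain ⟨rfl, rfl⟩ := List.append_eq_nil_iff.1 h
    obtain ⟨rfl, e1⟩ := ih1 rfl
    obtain ⟨rfl, e2⟩ := ih2 rfl
    exact ⟨rfl, (hcongr e1 e2).trans (empty_hcomp _)⟩

/-- Flows without inputs and cups are determined by their output, if no literal is repeated. -/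
theorem CupFree.flowEq_of_nodup {φ ψ : FlowTerm [] q} (hφ : CupFree φ) (hψ : CupFree ψ)
    (hq : q.Nodup) : FlowEq φ ψ := by
  induction hn : q.length using Nat.strong_induction_on generalizing q with
  | _ n ih =>
    rcases q with _ | ⟨a, q⟩
    · exact (hφ.eq_empty rfl).2.trans (hψ.eq_empty rfl).2.symm
    -- There are no inputs, so the first output wire must come from a cap.
    · rcases hφ.exists_of_tgt (q₁ := []) rfl with ⟨_, _, _, _, k⟩ | ⟨l, r, φ', hφ', k⟩
      · simpa using k.1
      rcases hψ.exists_of_tgt (q₁ := []) rfl with ⟨_, _, _, _, k'⟩ | ⟨l', r', ψ', hψ', k'⟩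
      · simpa using k'.1
      obtain ⟨_, _, h, _, e⟩ := k
      obtain ⟨_, _, h', _, e'⟩ := k'
      obtain rfl : q = l ++ a.dual :: r := h
      have hd := (List.nodup_cons.1 hq).2
      -- The dual literal occurs only once in the output, so the other end of the cap is at the same
      -- place in both flows.
      obtain ⟨rfl, -, rfl⟩ : l = l' ∧ a.dual = a.dual ∧ r = r' := by
        have h' : l ++ a.dual :: r = l' ++ a.dual :: r' := h'
        have h1 : a.dual ∉ l ++ r := (List.nodup_middle.1 hd).notMem
        have h2 : a.dual ∉ l' ++ r' := (List.nodup_middle.1 (h' ▸ hd)).notMem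
        rw [List.mem_append, not_or] at h1 h2
        exact List.append_cons_inj_of_notMem h1.1 h1.2 |>.1 h'
      refine e.trans (FlowEq.trans ?_ e'.symm)
      refine comp_congr (comp_congr (hcongr (refl _) (ih _ ?_ hφ' hψ' ?_ rfl)) (refl _)) (refl _)
      · simp at hn ⊢
        omega
      · exact (List.nodup_middle.1 hd).of_cons

/-! ### Renaming of atoms -/

section Rename

variable {ℬ : Type u} (f : 𝒜 → ℬ)

/-- Renaming of the atom of a literal. -/
def Literal.map : Literal 𝒜 → Literal ℬ
  | .pos a => .pos (f a)
  | .neg a => .neg (f a)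

/-- Renaming of the atoms of a formula. -/
def Formula.map : Formula 𝒜 → Formula ℬ
  | .unit => .unit
  | .lit a => .lit (a.map f)
  | .par A B => .par A.map B.map
  | .seq A B => .seq A.map B.map
  | .tens A B => .tens A.map B.map

/-- Renaming of the atoms of an equation. -/
def EqAx.map : {A B : Formula 𝒜} → EqAx A B → EqAx (A.map f) (B.map f)
  | _, _, .tensAssoc _ _ _ => .tensAssoc _ _ _
  | _, _, .tensComm _ _ => .tensComm _ _
  | _, _, .tensUnit _ => .tensUnit _
  | _, _, .parAssoc _ _ _ => .parAssoc _ _ _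
  | _, _, .parComm _ _ => .parComm _ _
  | _, _, .parUnit _ => .parUnit _
  | _, _, .seqAssoc _ _ _ => .seqAssoc _ _ _
  | _, _, .seqUnitRight _ => .seqUnitRight _
  | _, _, .seqUnitLeft _ => .seqUnitLeft _

/-- Renaming of the atoms of a rule instance. -/
def Rule.map : {A B : Formula 𝒜} → Rule A B → Rule (A.map f) (B.map f)
  | _, _, .equiv e => .equiv (e.map f)
  | _, _, .equivSymm e => .equivSymm (e.map f)
  | _, _, .aiDown (.pos a) => .aiDown (.pos (f a))
  | _, _, .aiDown (.neg a) => .aiDown (.neg (f a))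
  | _, _, .switch _ _ _ => .switch _ _ _
  | _, _, .qDown _ _ _ _ => .qDown _ _ _ _

/-- Renaming of the atoms of a derivation. -/
def Deriv.map : {A B : Formula 𝒜} → Deriv A B → Deriv (A.map f) (B.map f)
  | _, _, .form _ => .form _
  | _, _, .par Φ Ψ => .par Φ.map Ψ.map
  | _, _, .seq Φ Ψ => .seq Φ.map Ψ.map
  | _, _, .tens Φ Ψ => .tens Φ.map Ψ.map
  | _, _, .step Φ r Ψ => .step Φ.map (r.map f) Ψ.map

/-- Renaming of the atoms of a flow. -/
def FlowTerm.map : {p q : List (Literal 𝒜)} → FlowTerm p q →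
    FlowTerm (p.map (Literal.map f)) (q.map (Literal.map f))
  | _, _, .empty => .empty
  | _, _, .wire a => .wire (a.map f)
  | _, _, .cross a b => .cross (a.map f) (b.map f)
  | _, _, .cap (.pos a) => .cap (.pos (f a))
  | _, _, .cap (.neg a) => .cap (.neg (f a))
  | _, _, .cup (.pos a) => .cup (.pos (f a))
  | _, _, .cup (.neg a) => .cup (.neg (f a))
  | _, _, .vcomp φ ψ => .vcomp φ.map ψ.map
  | _, _, @FlowTerm.hcomp _ p q s t φ ψ =>
      (List.map_append (f := Literal.map f) (l₁ := p) (l₂ := s)).symm ▸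
        (List.map_append (f := Literal.map f) (l₁ := q) (l₂ := t)).symm ▸
          FlowTerm.hcomp φ.map ψ.map

variable {A B : Formula 𝒜}

open FlowEq

/-- Transport along equalities of strings does not change a diagram; this absorbs the casts in the
renaming of horizontal composites. -/
theorem FlowEq.rec_rec {p q p' q' : List (Literal ℬ)} (hp : p = p') (hq : q = q')
    (φ : FlowTerm p q) : FlowEq (hp ▸ hq ▸ φ : FlowTerm p' q') φ := by
  subst hp hq
  exact refl _

theorem FlowTerm.map_hcomp (φ : FlowTerm p q) (ψ : FlowTerm s t) :
    FlowEq ((FlowTerm.hcomp φ ψ).map f) (.hcomp (φ.map f) (ψ.map f)) := rec_rec _ _ _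

theorem FlowTerm.map_id (p : List (Literal 𝒜)) :
    FlowEq ((FlowTerm.id p).map f) (FlowTerm.id (p.map (Literal.map f))) := by
  induction p with
  | nil => exact refl _
  | cons a p ih => exact (map_hcomp ..).trans (hcongr (refl _) ih)

theorem FlowTerm.map_idOf (h : p = q) :
    FlowEq ((FlowTerm.idOf h).map f) (FlowTerm.id (p.map (Literal.map f))) := by
  subst h
  exact map_id f p

theorem FlowEq.idOf_eq_map_idOf {p' q' : List (Literal ℬ)} (h : p = q) (h' : p' = q')
    (k : p' = p.map (Literal.map f)) :
    FlowEq (FlowTerm.idOf h') ((FlowTerm.idOf h).map f) :=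
  (idOf_eq h').trans ((of_eq k).trans (FlowTerm.map_idOf f h).symm)

theorem FlowTerm.map_crossOne (a : Literal 𝒜) (q : List (Literal 𝒜)) :
    FlowEq ((FlowTerm.crossOne a q).map f)
      (FlowTerm.crossOne (a.map f) (q.map (Literal.map f))) := by
  induction q with
  | nil => exact refl _
  | cons b q ih =>
    exact vcongr ((map_hcomp ..).trans (hcongr (refl _) (map_id ..)))
      ((map_hcomp ..).trans (hcongr (refl _) ih))

theorem FlowEq.crossing_congr {p q p' q' : List (Literal ℬ)} (hp : p = p') (hq : q = q') :
    FlowEq (FlowTerm.crossing p q) (FlowTerm.crossing p' q') := by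
  subst hp hq
  exact refl _

theorem FlowTerm.map_crossing (p q : List (Literal 𝒜)) :
    FlowEq ((FlowTerm.crossing p q).map f)
      (FlowTerm.crossing (p.map (Literal.map f)) (q.map (Literal.map f))) := by
  induction p with
  | nil => exact (map_idOf ..).trans (idOf_eq _).symm
  | cons a p ih =>
    refine vcongr ((map_hcomp ..).trans (hcongr (refl _) ih)) (vcongr ?_ ?_)
    · exact (map_hcomp ..).trans (hcongr (map_crossOne ..) (map_id ..))
    · exact (map_idOf ..).trans ((FlowEq.of_eq (by simp)).trans (idOf_eq _).symm)

theorem FlowEq.map {φ : FlowTerm p q} {ψ : FlowTerm p' q'} (h : FlowEq φ ψ) :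
    FlowEq (φ.map f) (ψ.map f) := by
  have m {p q s t : List (Literal 𝒜)} (φ : FlowTerm p q) (ψ : FlowTerm s t) :=
    FlowTerm.map_hcomp f φ ψ
  induction h with
  | refl φ => exact refl _
  | symm _ ih => exact ih.symm
  | trans _ _ ih ih' => exact ih.trans ih'
  | vcongr _ _ ih ih' => exact vcongr ih ih'
  | hcongr _ _ ih ih' => exact (m _ _).trans ((hcongr ih ih').trans (m _ _).symm)
  | vassoc φ ψ θ => exact vassoc ..
  | id_vcomp φ => exact (vcongr (FlowTerm.map_id ..) (refl _)).trans (id_vcomp _)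
  | vcomp_id φ => exact (vcongr (refl _) (FlowTerm.map_id ..)).trans (vcomp_id _)
  | hassoc φ ψ θ =>
    refine ((m _ _).trans (hcongr (m _ _) (refl _))).trans ((hassoc ..).trans ?_)
    exact (hcongr (refl _) (m _ _).symm).trans (m _ _).symm
  | empty_hcomp φ => exact (m _ _).trans (empty_hcomp _)
  | hcomp_empty φ => exact (m _ _).trans (hcomp_empty _)
  | interchange φ φ' ψ ψ' =>
    refine (m _ _).trans ((interchange ..).trans ?_)
    exact FlowEq.symm (vcongr (m _ _) (m _ _))
  | cross_cross a b => exact FlowEq.cross_cross _ _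
  | yangBaxter a b c =>
    refine FlowEq.trans (vcongr (m _ _) (vcongr (m _ _) (m _ _))) ((yangBaxter _ _ _).trans ?_)
    exact FlowEq.symm (vcongr (m _ _) (vcongr (m _ _) (m _ _)))
  | cap_cross_pos a => exact cap_cross_pos _
  | cap_cross_neg a => exact cap_cross_neg _
  | cross_cup_pos a => exact cross_cup_pos _
  | cross_cup_neg a => exact cross_cup_neg _
  | cap_slide a b =>
    cases a <;> exact FlowEq.trans (vcongr (m _ _) (m _ _)) ((cap_slide _ _).trans
      (FlowEq.symm (vcongr (m _ _) (m _ _))))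
  | cup_slide a b =>
    cases a <;> exact FlowEq.trans (vcongr (m _ _) (m _ _)) ((cup_slide _ _).trans
      (FlowEq.symm (vcongr (m _ _) (m _ _))))

theorem Formula.str_map (A : Formula 𝒜) : (A.map f).str = A.str.map (Literal.map f) := by
  induction A <;> simp_all [Formula.map, Formula.str]

theorem EqAx.flowTerm_map (e : EqAx A B) :
    FlowEq (e.map f).flowTerm (e.flowTerm.map f) := by
  cases e with
  | tensComm A B | parComm A B =>
    exact (crossing_congr (A.str_map f) (B.str_map f)).trans (FlowTerm.map_crossing ..).symm
  | seqUnitLeft => exact (of_eq (B.str_map f)).trans (FlowTerm.map_id ..).symm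
  | _ => exact idOf_eq_map_idOf f _ _ (by simp [Formula.str_map])

theorem EqAx.flowTermSymm_map (e : EqAx A B) :
    FlowEq (e.map f).flowTermSymm (e.flowTermSymm.map f) := by
  cases e with
  | tensComm A B | parComm A B =>
    exact (crossing_congr (B.str_map f) (A.str_map f)).trans (FlowTerm.map_crossing ..).symm
  | seqUnitLeft => exact (of_eq (B.str_map f)).trans (FlowTerm.map_id ..).symm
  | _ => exact idOf_eq_map_idOf f _ _ (by simp [Formula.str_map])

theorem Rule.flowTerm_map (r : Rule A B) :
    FlowEq (r.map f).flowTerm (r.flowTerm.map f) := by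
  cases r with
  | equiv e => exact e.flowTerm_map f
  | equivSymm e => exact e.flowTermSymm_map f
  | aiDown a => cases a <;> exact refl _
  | switch A B C => exact idOf_eq_map_idOf f _ _ (by simp [Formula.str_map])
  | qDown A B C D =>
    refine vcongr (idOf_eq_map_idOf f _ _ (by simp [Formula.str_map])) (vcongr ?_
      (idOf_eq_map_idOf f _ _ (by simp [Formula.str_map])))
    refine FlowEq.symm (((FlowTerm.map_hcomp ..).trans
      (hcongr (FlowTerm.map_id ..) ((FlowTerm.map_hcomp ..).trans
        (hcongr (FlowTerm.map_crossing ..) (FlowTerm.map_id ..))))).trans ?_)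
    exact hcongr (of_eq (A.str_map f).symm) (hcongr
      (crossing_congr (B.str_map f).symm (C.str_map f).symm) (of_eq (D.str_map f).symm))

theorem Deriv.flowTerm_map (Φ : Deriv A B) : FlowEq (Φ.map f).flowTerm (Φ.flowTerm.map f) := by
  induction Φ with
  | form A => exact (of_eq (A.str_map f)).trans (FlowTerm.map_id ..).symm
  | par Φ Ψ h h' => exact (hcongr h h').trans (FlowTerm.map_hcomp ..).symm
  | seq Φ Ψ h h' => exact (hcongr h h').trans (FlowTerm.map_hcomp ..).symm
  | tens Φ Ψ h h' => exact (hcongr h h').trans (FlowTerm.map_hcomp ..).symm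
  | step Φ r Ψ h h' => exact vcongr h (vcongr (r.flowTerm_map f) h')

end Rename

/-! ### Derivations with distinct names -/

namespace CupFree

theorem crossOne (a : Literal 𝒜) (q : List (Literal 𝒜)) : CupFree (FlowTerm.crossOne a q) := by
  induction q with
  | nil => exact .wire a
  | cons b q ih => exact .vcomp (.hcomp (.cross a b) (.id q)) (.hcomp (.wire b) ih)

theorem crossing (p q : List (Literal 𝒜)) : CupFree (FlowTerm.crossing p q) := by
  induction p with
  | nil => exact .idOf _
  | cons a p ih =>
    exact .vcomp (.hcomp (.wire a) ih) (.vcomp (.hcomp (crossOne a q) (.id p)) (.idOf _))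

end CupFree

variable {A B : Formula 𝒜}

theorem Rule.cupFree (r : Rule A B) : CupFree r.flowTerm := by
  cases r with
  | equiv e => cases e <;> first | exact .idOf _ | exact .crossing _ _ | exact .id _
  | equivSymm e => cases e <;> first | exact .idOf _ | exact .crossing _ _ | exact .id _
  | aiDown a => exact .cap a
  | switch A B C => exact .idOf _
  | qDown A B C D =>
    exact .vcomp (.idOf _) (.vcomp (.hcomp (.id _) (.hcomp (.crossing _ _) (.id _))) (.idOf _))

theorem Deriv.cupFree (Φ : Deriv A B) : CupFree Φ.flowTerm := by
  induction Φ with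
  | form A => exact .id _
  | par Φ Ψ h h' => exact .hcomp h h'
  | seq Φ Ψ h h' => exact .hcomp h h'
  | tens Φ Ψ h h' => exact .hcomp h h'
  | step Φ r Ψ h h' => exact .vcomp h (.vcomp r.cupFree h')

/-- The number in the name of a numbered literal. -/
def Literal.index : Literal (𝒜 × ℕ) → ℕ
  | .pos a => a.2
  | .neg a => a.2

/-- Removal of the numbers from a formula with numbered atoms. -/
abbrev Formula.erase (A : Formula (𝒜 × ℕ)) : Formula 𝒜 := A.map Prod.fst

theorem Formula.erase_eq_unit {A : Formula (𝒜 × ℕ)} : A.erase = .unit ↔ A = .unit := by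
  cases A <;> simp [Formula.map]

theorem Formula.erase_eq_lit {A : Formula (𝒜 × ℕ)} {a : Literal 𝒜} :
    A.erase = .lit a ↔ ∃ b, b.map Prod.fst = a ∧ A = .lit b := by
  cases A <;> simp [Formula.map]

theorem Formula.erase_eq_par {A : Formula (𝒜 × ℕ)} {B C : Formula 𝒜} :
    A.erase = .par B C ↔ ∃ B' C', B'.erase = B ∧ C'.erase = C ∧ A = .par B' C' := by
  cases A <;> simp [Formula.map]

theorem Formula.erase_eq_seq {A : Formula (𝒜 × ℕ)} {B C : Formula 𝒜} :
    A.erase = .seq B C ↔ ∃ B' C', B'.erase = B ∧ C'.erase = C ∧ A = .seq B' C' := by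
  cases A <;> simp [Formula.map]

theorem Formula.erase_eq_tens {A : Formula (𝒜 × ℕ)} {B C : Formula 𝒜} :
    A.erase = .tens B C ↔ ∃ B' C', B'.erase = B ∧ C'.erase = C ∧ A = .tens B' C' := by
  cases A <;> simp [Formula.map]

/-- The literals in `L` are distinct, with numbers in `[n, m)`. -/
def Fresh (L : Multiset (Literal (𝒜 × ℕ))) (n m : ℕ) : Prop :=
  n ≤ m ∧ L.Nodup ∧ ∀ x ∈ L, n ≤ x.index ∧ x.index < m

theorem Fresh.zero (n : ℕ) : Fresh (0 : Multiset (Literal (𝒜 × ℕ))) n n :=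
  ⟨le_rfl, by simp, by simp⟩

theorem Fresh.add {L L' : Multiset (Literal (𝒜 × ℕ))} {n m k : ℕ}
    (h : Fresh L n m) (h' : Fresh L' m k) : Fresh (L + L') n k := by
  obtain ⟨h1, h2, h3⟩ := h
  obtain ⟨k1, k2, k3⟩ := h'
  refine ⟨h1.trans k1, Multiset.Nodup.add_iff h2 k2 |>.2 ?_, fun x hx => ?_⟩
  · exact Multiset.disjoint_left.2 fun hx hx' => by
      have := (h3 _ hx).2
      have := (k3 _ hx').1
      omega
  · rcases Multiset.mem_add.1 hx with hx | hx
    · exact ⟨(h3 x hx).1, (h3 x hx).2.trans_le k1⟩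
    · exact ⟨h1.trans (k3 x hx).1, (k3 x hx).2⟩

-- Lifting rules and derivations to numbered atoms

theorem EqAx.coe_str_eq (e : EqAx A B) : (A.str : Multiset (Literal 𝒜)) = B.str := by
  cases e <;> simp only [Formula.str, ← Multiset.coe_add, Multiset.coe_nil] <;> abel

theorem EqAx.exists_lift (e : EqAx A B) {A' : Formula (𝒜 × ℕ)} (hA : A'.erase = A) :
    ∃ (B' : Formula (𝒜 × ℕ)) (e' : EqAx A' B'), B'.erase = B ∧
      FlowEq (e'.map Prod.fst).flowTerm e.flowTerm := by
  cases e <;> simp only [Formula.erase_eq_par, Formula.erase_eq_seq, Formula.erase_eq_tens,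
    Formula.erase_eq_unit] at hA
  · obtain ⟨_, C, ⟨A, B, rfl, rfl, rfl⟩, rfl, rfl⟩ := hA
    exact ⟨_, .tensAssoc A B C, rfl, .refl _⟩
  · obtain ⟨A, B, rfl, rfl, rfl⟩ := hA
    exact ⟨_, .tensComm A B, rfl, .refl _⟩
  · obtain ⟨A, _, rfl, rfl, rfl⟩ := hA
    exact ⟨_, .tensUnit A, rfl, .refl _⟩
  · obtain ⟨_, C, ⟨A, B, rfl, rfl, rfl⟩, rfl, rfl⟩ := hA
    exact ⟨_, .parAssoc A B C, rfl, .refl _⟩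
  · obtain ⟨A, B, rfl, rfl, rfl⟩ := hA
    exact ⟨_, .parComm A B, rfl, .refl _⟩
  · obtain ⟨A, _, rfl, rfl, rfl⟩ := hA
    exact ⟨_, .parUnit A, rfl, .refl _⟩
  · obtain ⟨_, C, ⟨A, B, rfl, rfl, rfl⟩, rfl, rfl⟩ := hA
    exact ⟨_, .seqAssoc A B C, rfl, .refl _⟩
  · obtain ⟨A, _, rfl, rfl, rfl⟩ := hA
    exact ⟨_, .seqUnitRight A, rfl, .refl _⟩
  · obtain ⟨_, A, rfl, rfl, rfl⟩ := hA
    exact ⟨_, .seqUnitLeft A, rfl, .refl _⟩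

theorem EqAx.exists_lift_symm (e : EqAx A B) {B' : Formula (𝒜 × ℕ)} (hB : B'.erase = B) :
    ∃ (A' : Formula (𝒜 × ℕ)) (e' : EqAx A' B'), A'.erase = A ∧
      FlowEq (e'.map Prod.fst).flowTermSymm e.flowTermSymm := by
  subst hB
  generalize hB : B'.erase = B at e
  cases e with
  | tensUnit => subst hB; exact ⟨_, .tensUnit B', rfl, .refl _⟩
  | parUnit => subst hB; exact ⟨_, .parUnit B', rfl, .refl _⟩
  | seqUnitRight => subst hB; exact ⟨_, .seqUnitRight B', rfl, .refl _⟩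
  | seqUnitLeft => subst hB; exact ⟨_, .seqUnitLeft B', rfl, .refl _⟩
  | tensAssoc =>
    simp only [Formula.erase_eq_tens] at hB
    obtain ⟨A, _, rfl, ⟨B, C, rfl, rfl, rfl⟩, rfl⟩ := hB
    exact ⟨_, .tensAssoc A B C, rfl, .refl _⟩
  | tensComm =>
    simp only [Formula.erase_eq_tens] at hB
    obtain ⟨A, B, rfl, rfl, rfl⟩ := hB
    exact ⟨_, .tensComm B A, rfl, .refl _⟩
  | parAssoc =>
    simp only [Formula.erase_eq_par] at hB
    obtain ⟨A, _, rfl, ⟨B, C, rfl, rfl, rfl⟩, rfl⟩ := hB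
    exact ⟨_, .parAssoc A B C, rfl, .refl _⟩
  | parComm =>
    simp only [Formula.erase_eq_par] at hB
    obtain ⟨A, B, rfl, rfl, rfl⟩ := hB
    exact ⟨_, .parComm B A, rfl, .refl _⟩
  | seqAssoc =>
    simp only [Formula.erase_eq_seq] at hB
    obtain ⟨A, _, rfl, ⟨B, C, rfl, rfl, rfl⟩, rfl⟩ := hB
    exact ⟨_, .seqAssoc A B C, rfl, .refl _⟩

/-- Lifting proceeds from premise to conclusion: no rule deletes a literal, and only `ai↓` creates
any. It uses the number `n` for both of its literals, which differ in sign, and passes on `n + 1`;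
the other rules permute the literals. -/
theorem Rule.exists_lift (r : Rule A B) {A' : Formula (𝒜 × ℕ)} (hA : A'.erase = A) (n : ℕ) :
    ∃ (B' : Formula (𝒜 × ℕ)) (r' : Rule A' B') (L : Multiset (Literal (𝒜 × ℕ))) (m : ℕ),
      B'.erase = B ∧ FlowEq (r'.map Prod.fst).flowTerm r.flowTerm ∧ Fresh L n m ∧
      (B'.str : Multiset (Literal (𝒜 × ℕ))) = A'.str + L := by
  cases r with
  | equiv e =>
    obtain ⟨B', e', h, k⟩ := e.exists_lift hA
    exact ⟨B', .equiv e', 0, n, h, k, .zero n, by rw [add_zero, e'.coe_str_eq]⟩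
  | equivSymm e =>
    obtain ⟨B', e', h, k⟩ := e.exists_lift_symm hA
    exact ⟨B', .equivSymm e', 0, n, h, k, .zero n, by rw [add_zero, e'.coe_str_eq]⟩
  | aiDown a =>
    obtain rfl := Formula.erase_eq_unit.1 hA
    cases a with
    | pos a =>
      refine ⟨_, .aiDown (.pos (a, n)), {.pos (a, n), .neg (a, n)}, n + 1, rfl, .refl _,
        ⟨by simp, by simp, by simp [Literal.index]⟩, rfl⟩
    | neg a =>
      refine ⟨_, .aiDown (.neg (a, n)), {.neg (a, n), .pos (a, n)}, n + 1, rfl, .refl _,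
        ⟨by simp, by simp, by simp [Literal.index]⟩, rfl⟩
  | switch =>
    simp only [Formula.erase_eq_par, Formula.erase_eq_tens] at hA
    obtain ⟨A, _, rfl, ⟨B, C, rfl, rfl, rfl⟩, rfl⟩ := hA
    exact ⟨_, .switch A B C, 0, n, rfl, .refl _, .zero n, by simp [Formula.str]⟩
  | qDown =>
    simp only [Formula.erase_eq_par, Formula.erase_eq_seq] at hA
    obtain ⟨_, _, ⟨A, B, rfl, rfl, rfl⟩, ⟨C, D, rfl, rfl, rfl⟩, rfl⟩ := hA
    refine ⟨_, .qDown A B C D, 0, n, rfl, .refl _, .zero n, ?_⟩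
    simp only [Formula.str, ← Multiset.coe_add]
    abel

/-- A derivation lifts to one in which all interactions create different atoms. -/
theorem Deriv.exists_lift (Φ : Deriv A B) {A' : Formula (𝒜 × ℕ)} (hA : A'.erase = A) (n : ℕ) :
    ∃ (B' : Formula (𝒜 × ℕ)) (Φ' : Deriv A' B') (L : Multiset (Literal (𝒜 × ℕ))) (m : ℕ),
      B'.erase = B ∧ FlowEq (Φ'.map Prod.fst).flowTerm Φ.flowTerm ∧ Fresh L n m ∧
      (B'.str : Multiset (Literal (𝒜 × ℕ))) = A'.str + L := by
  induction Φ generalizing A' n with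
  | form A =>
    subst hA
    exact ⟨A', .form A', 0, n, rfl, .refl _, .zero n, by simp⟩
  | par Φ Ψ ih ih' =>
    obtain ⟨A₁, A₂, h₁, h₂, rfl⟩ := Formula.erase_eq_par.1 hA
    obtain ⟨B₁, Φ₁, L₁, m, rfl, f₁, l₁, s₁⟩ := ih h₁ n
    -- The second factor starts numbering where the first one stops, which keeps the new literals
    -- distinct.
    obtain ⟨B₂, Φ₂, L₂, k, rfl, f₂, l₂, s₂⟩ := ih' h₂ m
    refine ⟨_, .par Φ₁ Φ₂, L₁ + L₂, k, rfl, .hcongr f₁ f₂, l₁.add l₂, ?_⟩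
    simp only [Formula.str, ← Multiset.coe_add, s₁, s₂]
    abel
  | seq Φ Ψ ih ih' =>
    obtain ⟨A₁, A₂, h₁, h₂, rfl⟩ := Formula.erase_eq_seq.1 hA
    obtain ⟨B₁, Φ₁, L₁, m, rfl, f₁, l₁, s₁⟩ := ih h₁ n
    obtain ⟨B₂, Φ₂, L₂, k, rfl, f₂, l₂, s₂⟩ := ih' h₂ m
    refine ⟨_, .seq Φ₁ Φ₂, L₁ + L₂, k, rfl, .hcongr f₁ f₂, l₁.add l₂, ?_⟩
    simp only [Formula.str, ← Multiset.coe_add, s₁, s₂]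
    abel
  | tens Φ Ψ ih ih' =>
    obtain ⟨A₁, A₂, h₁, h₂, rfl⟩ := Formula.erase_eq_tens.1 hA
    obtain ⟨B₁, Φ₁, L₁, m, rfl, f₁, l₁, s₁⟩ := ih h₁ n
    obtain ⟨B₂, Φ₂, L₂, k, rfl, f₂, l₂, s₂⟩ := ih' h₂ m
    refine ⟨_, .tens Φ₁ Φ₂, L₁ + L₂, k, rfl, .hcongr f₁ f₂, l₁.add l₂, ?_⟩
    simp only [Formula.str, ← Multiset.coe_add, s₁, s₂]
    abel
  | step Φ r Ψ ih ih' =>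
    obtain ⟨B₁, Φ₁, L₁, m, h₁, f₁, l₁, s₁⟩ := ih hA n
    obtain ⟨B₂, r', L₂, k, h₂, f₂, l₂, s₂⟩ := r.exists_lift h₁ m
    obtain ⟨B₃, Φ₃, L₃, j, h₃, f₃, l₃, s₃⟩ := ih' h₂ k
    refine ⟨_, .step Φ₁ r' Φ₃, L₁ + L₂ + L₃, j, h₃, .vcongr f₁ (.vcongr f₂ f₃),
      (l₁.add l₂).add l₃, ?_⟩
    simp only [s₁, s₂, s₃]
    abel

/-- A proof lifts to a proof of a formula without repeated literals. -/
theorem Deriv.exists_lift_nodup (Φ : Proof A) :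
    ∃ (A' : Formula (𝒜 × ℕ)) (Φ' : Proof A'), A'.erase = A ∧ A'.str.Nodup ∧
      FlowEq (Φ'.map Prod.fst).flowTerm Φ.flowTerm := by
  obtain ⟨A', Φ', L, m, h, f, l, s⟩ := Φ.exists_lift (A' := .unit) rfl 0
  refine ⟨A', Φ', h, ?_, f⟩
  -- The unit has no literals, so all literals of the conclusion are fresh ones.
  rw [← Multiset.coe_nodup, s]
  simpa [Formula.str] using l.2.1

/-- Proofs of a formula without repeated literals have the same flow after renaming. -/
theorem Deriv.flowEq_map_of_nodup {ℬ : Type u} (f : 𝒜 → ℬ) (hA : A.str.Nodup) (Φ Ψ : Proof A) :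
    FlowEq (Φ.map f).flowTerm (Ψ.map f).flowTerm :=
  (Φ.flowTerm_map f).trans (((Φ.cupFree.flowEq_of_nodup Ψ.cupFree hA).map f).trans
    (Ψ.flowTerm_map f).symm)

end BV

-- Splitting with flows

theorem mainTheorem2 {𝒜 : Type*} (A B K : BV.Formula 𝒜) (a : BV.Literal 𝒜) :
    (∀ Φ : BV.Proof (.par (.tens A B) K),
      ∃ (K₁ K₂ : BV.Formula 𝒜) (ΦK : BV.Deriv (.par K₁ K₂) K)
        (ΦA : BV.Proof (.par A K₁)) (ΦB : BV.Proof (.par B K₂)),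
        (BV.recombineTens ΦA ΦB ΦK).flow = Φ.flow) ∧
    (∀ Φ : BV.Proof (.par (.seq A B) K),
      ∃ (K₁ K₂ : BV.Formula 𝒜) (ΦK : BV.Deriv (.seq K₁ K₂) K)
        (ΦA : BV.Proof (.par A K₁)) (ΦB : BV.Proof (.par B K₂)),
        (BV.recombineSeq ΦA ΦB ΦK).flow = Φ.flow) ∧
    (∀ Φ : BV.Proof (.par (.lit a) K),
      ∃ Φa : BV.Deriv (.lit a.dual) K, (BV.recombineLit Φa).flow = Φ.flow) := by
  refine ⟨fun Φ => ?_, fun Φ => ?_, fun Φ => ?_⟩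
  all_goals obtain ⟨F, Φ', h, hF, e⟩ := Φ.exists_lift_nodup
  · simp only [BV.Formula.erase_eq_par, BV.Formula.erase_eq_tens] at h
    obtain ⟨_, K, ⟨A, B, rfl, rfl, rfl⟩, rfl, rfl⟩ := h
    obtain ⟨K₁, K₂, ⟨ΦK⟩, ⟨ΦA⟩, ⟨ΦB⟩⟩ := BV.splitting_tens Φ'
    -- Recombination commutes with renaming by computation, so uniqueness of the flow for the
    -- numbered formula applies to the recombined proof.
    exact ⟨_, _, ΦK.map Prod.fst, ΦA.map Prod.fst, ΦB.map Prod.fst, Quotient.sound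
      ((BV.Deriv.flowEq_map_of_nodup Prod.fst hF (BV.recombineTens ΦA ΦB ΦK) Φ').trans e)⟩
  · simp only [BV.Formula.erase_eq_par, BV.Formula.erase_eq_seq] at h
    obtain ⟨_, K, ⟨A, B, rfl, rfl, rfl⟩, rfl, rfl⟩ := h
    obtain ⟨K₁, K₂, ⟨ΦK⟩, ⟨ΦA⟩, ⟨ΦB⟩⟩ := BV.splitting_seq Φ'
    exact ⟨_, _, ΦK.map Prod.fst, ΦA.map Prod.fst, ΦB.map Prod.fst, Quotient.sound
      ((BV.Deriv.flowEq_map_of_nodup Prod.fst hF (BV.recombineSeq ΦA ΦB ΦK) Φ').trans e)⟩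
  · simp only [BV.Formula.erase_eq_par, BV.Formula.erase_eq_lit] at h
    obtain ⟨_, K, ⟨a, rfl, rfl⟩, rfl, rfl⟩ := h
    obtain ⟨Φa⟩ := BV.splitting_lit Φ'
    have e' := (BV.Deriv.flowEq_map_of_nodup Prod.fst hF (BV.recombineLit Φa) Φ').trans e
    -- Renaming commutes with dualization by computation only after the sign is fixed.
    cases a with
    | pos a => exact ⟨Φa.map Prod.fst, Quotient.sound e'⟩
    | neg a => exact ⟨Φa.map Prod.fst, Quotient.sound e'⟩
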